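/- Let $k$ be a field and let $S$ be a $k$-algebra with an exhaustive filtration $\Gamma=(\Gamma_n)_{n\ge 0}$ by $k$-subspaces $\Gamma_0\subseteq\Gamma_1\subseteq\cdots$, with $1\in\Gamma_0$ and $\Gamma_i\Gamma_j\subseteq\Gamma_{i+j}$, such that the associated graded algebra $\operatorname{gr}_\Gamma S=\bigoplus_{n\ge0}\Gamma_n/\Gamma_{n-1}$ (where $\Gamma_{-1}=0$) is a commutative domain. Let $R_1,R_2\subseteq S$ be $k$-subalgebras, each with the induced filtration $(\Gamma_n\cap R_i)_n$, so that $\operatorname{gr}_\Gamma R_i\subseteq\operatorname{gr}_\Gamma S$. Assume: 1. each $R_i$ is a (two-sided) Goldie domain, and $S$ is contained in a division ring $F$ which is the common Goldie quotient ring of $R_1$ and $R_2$; 2. each $\operatorname{gr}_\Gamma R_i$ is a Gorenstein ring (commutative, noetherian, and every localization at a prime ideal has finite injective dimension over itself), and there is a graded finitely generated $k$-subalgebra $C\subseteq\operatorname{gr}_\Gamma S$, contained in both $\operatorname{gr}_\Gamma R_1$ and $\operatorname{gr}_\Gamma R_2$, over which both are finitely generated modules; 3. for $i=1,2$ and every nonzero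 two-sided ideal $I$ of $R_i$, $\operatorname{GKdim}(R_i/I)\le\operatorname{GKdim}(R_i)-2$, where $\operatorname{GKdim}$ is the Gelfand–Kirillov dimension over $k$ and $\operatorname{GKdim}(0)=-\infty$. For a nonzero left $R_1$-submodule $M\subseteq S$ put $M^*=\{f\in F: Mf\subseteq R_1\}$ and $M^{**}=\{g\in F: gM^*\subseteq R_1\}$ (these are the usual identifications of $\operatorname{Hom}_{R_1}(M,R_1)$ and of its dual with subsets of $F$), and call $M$ reflexive as a left $R_1$-module if $M^{**}=M$. Reflexivity of right $R_2$-submodules is defined symmetrically. Let $M$ be a nonzero $(R_1,R_2)$-bisubmodule of $S$ (an additive subgroup with $R_1M\subseteq M$ and $MR_2\subseteq M$) which is finitely generated and reflexive on at least one side, i.e. as a left $R_1$-module or as a right $R_2$-module. Then $M$ is finitely generated and reflexive both as a left $R_1$-module and as a right $R_2$-module. Moreover $M$ is the unique such bimodule: if $N$ is any nonzero $(R_1,R_2)$-bisubmodule of $S$ that is finitely generated and reflexive on at least one side (not necessarily the same side as $M$), then $N=M$. -/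

import Mathlib

/-- An exhaustive `ℕ`-indexed algebra filtration `Γ₀ ⊆ Γ₁ ⊆ ⋯` of a `k`-algebra `A`
by `k`-subspaces. -/
structure AlgFiltration (k A : Type*) [Field k] [Ring A] [Algebra k A] where
  piece : ℕ → Submodule k A
  mono : Monotone piece
  one_mem : (1 : A) ∈ piece 0
  mul_mem : ∀ {i j : ℕ} {a b : A}, a ∈ piece i → b ∈ piece j → a * b ∈ piece (i + j)
  exhaustive : ∀ a : A, ∃ n, a ∈ piece n

namespace AlgFiltration

variable {k A : Type*} [Field k] [Ring A] [Algebra k A]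

/-- The induced filtration `Γₙ ∩ R` on a subalgebra `R`. -/
def induced (Γ : AlgFiltration k A) (R : Subalgebra k A) : AlgFiltration k R where
  piece n := (Γ.piece n).comap R.val.toLinearMap
  mono _ _ h _ ha := Γ.mono h ha
  one_mem := Γ.one_mem
  mul_mem ha hb := Γ.mul_mem ha hb
  exhaustive a := Γ.exhaustive a

/-- The preceding piece `Γ_{n-1}`, with `Γ_{-1} = 0`. -/
def below (Γ : AlgFiltration k A) : ℕ → Submodule k A
  | 0 => ⊥
  | n + 1 => Γ.piece n

theorem mul_mem_below_right (Γ : AlgFiltration k A) {i j : ℕ} {a b : A}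
    (ha : a ∈ Γ.piece i) (hb : b ∈ Γ.below j) : a * b ∈ Γ.below (i + j) := by
  cases j with
  | zero =>
    have hb0 : b = 0 := hb
    rw [hb0, mul_zero]
    exact zero_mem _
  | succ j => exact Γ.mul_mem ha hb

theorem mul_mem_below_left (Γ : AlgFiltration k A) {i j : ℕ} {a b : A}
    (ha : a ∈ Γ.below i) (hb : b ∈ Γ.piece j) : a * b ∈ Γ.below (i + j) := by
  cases i with
  | zero =>
    have ha0 : a = 0 := ha
    rw [ha0, zero_mul]
    exact zero_mem _
  | succ i =>
    rw [Nat.add_right_comm]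
    exact Γ.mul_mem ha hb

/-- The degree `n` component `Γₙ / Γ_{n-1}` of the associated graded algebra. -/
def GrPiece (Γ : AlgFiltration k A) (n : ℕ) : Type _ :=
  Γ.piece n ⧸ (Γ.below n).comap (Γ.piece n).subtype

instance (Γ : AlgFiltration k A) (n : ℕ) : AddCommGroup (Γ.GrPiece n) :=
  inferInstanceAs (AddCommGroup (Γ.piece n ⧸ (Γ.below n).comap (Γ.piece n).subtype))

instance (Γ : AlgFiltration k A) (n : ℕ) : Module k (Γ.GrPiece n) :=
  inferInstanceAs (Module k (Γ.piece n ⧸ (Γ.below n).comap (Γ.piece n).subtype))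

/-- The class in `Γₙ / Γ_{n-1}` of an element of `Γₙ`. -/
def symb (Γ : AlgFiltration k A) (n : ℕ) : Γ.piece n →ₗ[k] Γ.GrPiece n :=
  Submodule.mkQ ((Γ.below n).comap (Γ.piece n).subtype)

theorem symb_surjective (Γ : AlgFiltration k A) (n : ℕ) : Function.Surjective (Γ.symb n) :=
  Submodule.mkQ_surjective _

theorem symb_eq_zero (Γ : AlgFiltration k A) {n : ℕ} {a : Γ.piece n}
    (ha : (a : A) ∈ Γ.below n) : Γ.symb n a = 0 :=
  (Submodule.Quotient.mk_eq_zero _).2 ha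

/-- Multiplication `Γᵢ × Γⱼ → Γ_{i+j}`. -/
def pieceMul (Γ : AlgFiltration k A) (i j : ℕ) :
    Γ.piece i →ₗ[k] Γ.piece j →ₗ[k] Γ.piece (i + j) :=
  LinearMap.mk₂ k (fun a b => ⟨a * b, Γ.mul_mem a.2 b.2⟩)
    (fun _ _ _ => Subtype.ext (add_mul _ _ _)) (fun _ _ _ => Subtype.ext (smul_mul_assoc _ _ _))
    (fun _ _ _ => Subtype.ext (mul_add _ _ _)) (fun _ _ _ => Subtype.ext (mul_smul_comm _ _ _))

/-- The product `(a + Γ_{i-1}) (b + Γ_{j-1}) = a b + Γ_{i+j-1}`. -/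
def grMul (Γ : AlgFiltration k A) (i j : ℕ) :
    Γ.GrPiece i →ₗ[k] Γ.GrPiece j →ₗ[k] Γ.GrPiece (i + j) :=
  Submodule.liftQ ((Γ.below i).comap (Γ.piece i).subtype)
    { toFun := fun a => Submodule.liftQ ((Γ.below j).comap (Γ.piece j).subtype) (Γ.symb (i + j) ∘ₗ Γ.pieceMul i j a)
        (fun b hb => Γ.symb_eq_zero (Γ.mul_mem_below_right a.2 hb))
      map_add' := fun a a' => by
        refine LinearMap.ext fun y => ?_
        obtain ⟨b, rfl⟩ := Submodule.mkQ_surjective _ y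
        change Γ.symb _ (Γ.pieceMul i j (a + a') b) =
          Γ.symb _ (Γ.pieceMul i j a b) + Γ.symb _ (Γ.pieceMul i j a' b)
        rw [map_add, LinearMap.add_apply, map_add]
      map_smul' := fun c a => by
        refine LinearMap.ext fun y => ?_
        obtain ⟨b, rfl⟩ := Submodule.mkQ_surjective _ y
        change Γ.symb _ (Γ.pieceMul i j (c • a) b) = c • Γ.symb _ (Γ.pieceMul i j a b)
        rw [map_smul, LinearMap.smul_apply, map_smul] }
    (fun a ha => by
      refine LinearMap.ext fun y => ?_
      obtain ⟨b, rfl⟩ := Submodule.mkQ_surjective _ y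
      exact Γ.symb_eq_zero (Γ.mul_mem_below_left ha b.2))

theorem grMul_symb (Γ : AlgFiltration k A) {i j : ℕ} (a : Γ.piece i) (b : Γ.piece j) :
    Γ.grMul i j (Γ.symb i a) (Γ.symb j b) =
      Γ.symb (i + j) ⟨a * b, Γ.mul_mem a.2 b.2⟩ := rfl

theorem mk_symb_eq (Γ : AlgFiltration k A) {i j : ℕ} (h : i = j) (a : Γ.piece i) (b : Γ.piece j)
    (hab : (a : A) = b) :
    GradedMonoid.mk (A := Γ.GrPiece) i (Γ.symb i a) = GradedMonoid.mk j (Γ.symb j b) := by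
  subst h
  rw [Subtype.ext hab]

instance (Γ : AlgFiltration k A) : GradedMonoid.GMul Γ.GrPiece where
  mul x y := Γ.grMul _ _ x y

instance (Γ : AlgFiltration k A) : GradedMonoid.GOne Γ.GrPiece where
  one := Γ.symb 0 ⟨1, Γ.one_mem⟩

theorem algebraMap_mem (Γ : AlgFiltration k A) (c : k) : algebraMap k A c ∈ Γ.piece 0 := by
  rw [Algebra.algebraMap_eq_smul_one]
  exact (Γ.piece 0).smul_mem c Γ.one_mem

instance (Γ : AlgFiltration k A) : DirectSum.GRing Γ.GrPiece where
  mul_zero a := map_zero _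
  zero_mul b := by
    change Γ.grMul _ _ 0 b = 0
    rw [map_zero]
    rfl
  mul_add a b c := map_add _ _ _
  add_mul a b c := by
    change Γ.grMul _ _ (a + b) c = Γ.grMul _ _ a c + Γ.grMul _ _ b c
    rw [map_add]
    rfl
  one_mul := by
    rintro ⟨i, x⟩
    obtain ⟨a, rfl⟩ := Γ.symb_surjective i x
    exact Γ.mk_symb_eq (zero_add i) _ _ (one_mul _)
  mul_one := by
    rintro ⟨i, x⟩
    obtain ⟨a, rfl⟩ := Γ.symb_surjective i x
    exact Γ.mk_symb_eq (add_zero i) _ _ (mul_one _)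
  mul_assoc := by
    rintro ⟨i, x⟩ ⟨j, y⟩ ⟨l, z⟩
    obtain ⟨a, rfl⟩ := Γ.symb_surjective i x
    obtain ⟨b, rfl⟩ := Γ.symb_surjective j y
    obtain ⟨c, rfl⟩ := Γ.symb_surjective l z
    exact Γ.mk_symb_eq (add_assoc i j l) _ _ (mul_assoc _ _ _)
  natCast n := n • Γ.symb 0 ⟨1, Γ.one_mem⟩
  natCast_zero := zero_smul _ _
  natCast_succ n := succ_nsmul _ _
  intCast n := n • Γ.symb 0 ⟨1, Γ.one_mem⟩
  intCast_ofNat n := natCast_zsmul _ _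
  intCast_negSucc_ofNat n := negSucc_zsmul _ _

instance (Γ : AlgFiltration k A) : DirectSum.GAlgebra k Γ.GrPiece where
  toFun := (LinearMap.toSpanSingleton k _ (Γ.symb 0 ⟨1, Γ.one_mem⟩)).toAddMonoidHom
  map_one := one_smul k (Γ.symb 0 ⟨1, Γ.one_mem⟩)
  map_mul r s := by
    refine Γ.mk_symb_eq (add_zero 0) ((r * s) • ⟨1, Γ.one_mem⟩)
      ⟨(r • 1) * (s • 1), Γ.mul_mem (Submodule.smul_mem _ r Γ.one_mem)
        (Submodule.smul_mem _ s Γ.one_mem)⟩ ?_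
    simp [mul_smul, smul_comm r s]
  commutes r := by
    rintro ⟨i, x⟩
    obtain ⟨a, rfl⟩ := Γ.symb_surjective i x
    refine Γ.mk_symb_eq (add_comm 0 i) ⟨(r • 1) * a, Γ.mul_mem
      (Submodule.smul_mem _ r Γ.one_mem) a.2⟩ ⟨a * (r • 1), Γ.mul_mem a.2
      (Submodule.smul_mem _ r Γ.one_mem)⟩ ?_
    simp
  smul_def r := by
    rintro ⟨i, x⟩
    obtain ⟨a, rfl⟩ := Γ.symb_surjective i x
    refine Γ.mk_symb_eq (zero_add i).symm (r • a) ⟨(r • 1) * a, Γ.mul_mem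
      (Submodule.smul_mem _ r Γ.one_mem) a.2⟩ ?_
    simp

/-- The associated graded algebra `gr_Γ A = ⨁ₙ Γₙ / Γ_{n-1}`. -/
abbrev Gr (Γ : AlgFiltration k A) : Type _ := DirectSum ℕ Γ.GrPiece

/-- The inclusion `Γₙ ∩ R → Γₙ`. -/
def pieceIncl (Γ : AlgFiltration k A) (R : Subalgebra k A) (n : ℕ) :
    (Γ.induced R).piece n →ₗ[k] Γ.piece n where
  toFun a := ⟨(a : R), a.2⟩
  map_add' _ _ := rfl
  map_smul' _ _ := rfl

theorem pieceIncl_mem_below (Γ : AlgFiltration k A) (R : Subalgebra k A) {n : ℕ}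
    {a : (Γ.induced R).piece n} (ha : (a : R) ∈ (Γ.induced R).below n) :
    (Γ.pieceIncl R n a : A) ∈ Γ.below n := by
  cases n with
  | zero => exact congrArg Subtype.val (show (a : R) = 0 from ha)
  | succ n => exact ha

/-- The canonical map `(Γₙ ∩ R) / (Γ_{n-1} ∩ R) → Γₙ / Γ_{n-1}`. -/
def grPieceIncl (Γ : AlgFiltration k A) (R : Subalgebra k A) (n : ℕ) :
    (Γ.induced R).GrPiece n →ₗ[k] Γ.GrPiece n :=
  Submodule.liftQ (((Γ.induced R).below n).comap ((Γ.induced R).piece n).subtype)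
    (Γ.symb n ∘ₗ Γ.pieceIncl R n) (fun _ ha => Γ.symb_eq_zero (Γ.pieceIncl_mem_below R ha))

/-- The canonical (injective) map `gr_Γ R → gr_Γ A` for a subalgebra `R` of `A` with the induced
filtration. -/
def grIncl (Γ : AlgFiltration k A) (R : Subalgebra k A) : (Γ.induced R).Gr →ₗ[k] Γ.Gr :=
  DirectSum.lmap (Γ.grPieceIncl R)

/-- A subalgebra of `gr_Γ A` is graded if it contains the homogeneous components of each of its
elements. -/
def IsGradedSubalgebra (Γ : AlgFiltration k A) (C : Subalgebra k Γ.Gr) : Prop :=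
  ∀ x ∈ C, ∀ n : ℕ, DirectSum.of Γ.GrPiece n (x n) ∈ C

/-- `C` is a subalgebra of `gr_Γ R` (both regarded inside `gr_Γ A`) over which `gr_Γ R` is a
finitely generated module. -/
def GrFiniteOver (Γ : AlgFiltration k A) (R : Subalgebra k A) (C : Subalgebra k Γ.Gr) : Prop :=
  (C : Set Γ.Gr) ⊆ Set.range (Γ.grIncl R) ∧
    ∃ t : Finset Γ.Gr,
      (Submodule.span C (t : Set Γ.Gr) : Set Γ.Gr) = Set.range (Γ.grIncl R)

end AlgFiltration

/-- A Gorenstein ring: a commutative noetherian ring all of whose localizations at prime ideals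
have finite injective dimension as modules over themselves. -/
def IsGorensteinRing (A : Type*) [Ring A] : Prop :=
  ∃ hcomm : ∀ a b : A, a * b = b * a,
    letI : CommRing A := { ‹Ring A› with mul_comm := hcomm }
    IsNoetherianRing A ∧
      ∀ (p : Ideal A) [p.IsPrime], ∃ n : ℕ,
        CategoryTheory.HasInjectiveDimensionLE
          (ModuleCat.of (Localization.AtPrime p) (Localization.AtPrime p)) n

/-- The Gelfand-Kirillov dimension of a `k`-algebra `A`: the supremum over finite dimensional
subspaces `V` of `limsup log dim (k + V)ⁿ / log n`. The zero algebra has dimension `⊥ = -∞`. -/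
noncomputable def gkDim (k A : Type*) [Field k] [Ring A] [Algebra k A] : EReal :=
  ⨆ V : {V : Submodule k A // V.FG},
    Filter.limsup (fun n : ℕ =>
      ENNReal.log (Module.finrank k ((1 ⊔ V.1) ^ n : Submodule k A)) / ((Real.log n : ℝ) : EReal))
      Filter.atTop

section Bimodules

variable {k S F : Type*} [Field k] [Ring S] [Algebra k S] [DivisionRing F]

/-- The division ring `F`, with the embedding `ι : S → F`, is the (two-sided) Goldie quotient ring
of the subalgebra `R` of `S`: every element of `F` is a left fraction `b⁻¹ a` and a right
fraction `a b⁻¹` of elements of `R`. -/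
def IsGoldieQuotientRing (R : Subalgebra k S) (ι : S →+* F) : Prop :=
  ∀ x : F,
    (∃ a ∈ R, ∃ b ∈ R, ι b ≠ 0 ∧ x = (ι b)⁻¹ * ι a) ∧
    (∃ a ∈ R, ∃ b ∈ R, ι b ≠ 0 ∧ x = ι a * (ι b)⁻¹)

/-- `M ⊆ S` is an `(R₁, R₂)`-bisubmodule of `S`. -/
def IsBisubmodule (R₁ R₂ : Subalgebra k S) (M : AddSubgroup S) : Prop :=
  (∀ r ∈ R₁, ∀ m ∈ M, r * m ∈ M) ∧ (∀ m ∈ M, ∀ r ∈ R₂, m * r ∈ M)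

/-- `M` is finitely generated as a left `R`-module. -/
def LeftFG (R : Subalgebra k S) (M : AddSubgroup S) : Prop :=
  ∃ (n : ℕ) (g : Fin n → S), (∀ i, g i ∈ M) ∧
    ∀ m ∈ M, ∃ r : Fin n → R, m = ∑ i, (r i : S) * g i

/-- `M` is finitely generated as a right `R`-module. -/
def RightFG (R : Subalgebra k S) (M : AddSubgroup S) : Prop :=
  ∃ (n : ℕ) (g : Fin n → S), (∀ i, g i ∈ M) ∧
    ∀ m ∈ M, ∃ r : Fin n → R, m = ∑ i, g i * (r i : S)

/-- `{f ∈ F | X f ⊆ R}`: the dual `Hom_R(X, R)` of a left `R`-submodule `X` of `F`. -/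
def leftDual (R : Subalgebra k S) (ι : S →+* F) (X : Set F) : Set F :=
  {f | ∀ x ∈ X, x * f ∈ ι '' R}

/-- `{f ∈ F | f X ⊆ R}`: the dual `Hom_R(X, R)` of a right `R`-submodule `X` of `F`. -/
def rightDual (R : Subalgebra k S) (ι : S →+* F) (X : Set F) : Set F :=
  {f | ∀ x ∈ X, f * x ∈ ι '' R}

/-- `M` is reflexive as a left `R`-module: `M** = M` inside `F`. -/
def LeftReflexive (R : Subalgebra k S) (ι : S →+* F) (M : AddSubgroup S) : Prop :=
  rightDual R ι (leftDual R ι (ι '' M)) = ι '' M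

/-- `M` is reflexive as a right `R`-module: `M** = M` inside `F`. -/
def RightReflexive (R : Subalgebra k S) (ι : S →+* F) (M : AddSubgroup S) : Prop :=
  leftDual R ι (rightDual R ι (ι '' M)) = ι '' M

end Bimodules

/-! The heart of the proof is a cancellation property of `R = R₁` or `R₂`: if `I` is a nonzero
two-sided ideal and `y ∈ F` satisfies `I y ⊆ R` or `y I ⊆ R`, then `y ∈ R`. Writing `y` as a
fraction turns this into a divisibility statement in `R`, which is proved on symbols in `A = gr R`.
Let `J ⊆ A` be the ideal generated by the symbols of `I`.

The ideal `J` lies in no prime of height at most one. Let `A` be finite over a polynomial ring in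
`d` variables. If `J ⊆ P` with `P` of height at most one, then `d - 1` elements of `A` are
algebraically independent modulo `P`, and counting monomials gives `GKdim (R / I) ≥ d - 1`. Since
`GKdim R ≤ d`, this contradicts the drop by two. The bound on `GKdim R` cannot be read off from `dim
Γₙ`, which may be infinite; it comes from a Gröbner basis argument with weighted words
(`SymbolMap.gkDim_le_of_growth`).

In a Gorenstein domain the primes associated to a nonzero principal ideal have height at most one
(`height_le_one_of_mem_associatedPrimes`). Hence `J a ⊆ (b)` forces `b ∣ a`, and induction on the
filtration degree lifts this from `A` to `R`.

Cancellation gives the key inclusion (`LeftReflexive.subset`). Let `M` be left reflexive and let `X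
⊆ F` be left `R₁`-stable with `q X ⊆ R₂`, `q ≠ 0`. Then `{r ∈ R₁ | r X ⊆ M}` is a nonzero two-sided
ideal; it multiplies `X M*` into `R₁`, so `X M* ⊆ R₁` and `X ⊆ M** = M`. Taking for `X` the right
bidual of `M` transfers reflexivity to the other side; taking another bimodule gives uniqueness.

Finite generation changes sides through `C`: a common denominator embeds the symbols of `M` into one
`gr Rᵢ`, a noetherian `C`-module, and `C` also lies in the other `gr Rⱼ`. -/

/-! ### Primes associated to principal ideals in Gorenstein domains -/

section GorensteinLocal

open CategoryTheory Abelian IsLocalRing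

universe u

variable {A : Type u} [CommRing A]

/-- Over a noetherian local ring, `Extⁿ(A/P, Y)` vanishes for a nonmaximal prime `P` as soon as
`Extⁿ⁺¹(-, Y)` vanishes on finitely generated modules. -/
theorem subsingleton_ext_quotient_prime [IsLocalRing A] [IsNoetherianRing A] (Y : ModuleCat.{u} A)
    [Module.Finite A Y] (n : ℕ)
    (h : ∀ Z : ModuleCat.{u} A, Module.Finite A Z → Subsingleton (Ext Z Y (n + 1)))
    (P : Ideal A) [P.IsPrime] (hP : P ≠ maximalIdeal A) :
    Subsingleton (Ext (ModuleCat.of A (A ⧸ P)) Y n) := by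
  obtain ⟨x, hxm, hxP⟩ : ∃ x ∈ maximalIdeal A, x ∉ P := by
    by_contra! H
    exact hP (le_antisymm (le_maximalIdeal (Ideal.IsPrime.ne_top ‹_›)) H)
  have hreg : IsSMulRegular (ModuleCat.of A (A ⧸ P)) x := by
    refine isSMulRegular_iff_right_eq_zero_of_smul.2 fun y hy => ?_
    obtain ⟨y, rfl⟩ := Ideal.Quotient.mk_surjective y
    have h1 : Ideal.Quotient.mk P (x * y) = 0 := hy
    rw [Ideal.Quotient.eq_zero_iff_mem] at h1 ⊢
    exact (Ideal.IsPrime.mem_or_mem ‹_› h1).resolve_left hxP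
  have hS := hreg.smulShortComplex_shortExact
  have hfin : Module.Finite A ((ModuleCat.of A (A ⧸ P)).smulShortComplex x).X₃ :=
    have : Module.Finite A ((ModuleCat.of A (A ⧸ P)).smulShortComplex x).X₂ :=
      Module.Finite.of_surjective P.mkQ (Submodule.mkQ_surjective P)
    Module.Finite.of_surjective _ ((ModuleCat.epi_iff_surjective _).1 hS.epi_g)
  have := h _ hfin
  -- The cokernel of multiplication by `x` on `Extⁿ(A/P, Y)` embeds in `Extⁿ⁺¹` of `A/(P, x)`, which
  -- vanishes. As `Extⁿ` is a finite module, Nakayama then kills it.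
  have hsurj : (⊤ : Submodule A (Ext (ModuleCat.of A (A ⧸ P)) Y n)) ≤ (maximalIdeal A) • ⊤ := by
    intro y _
    obtain ⟨z, hz⟩ := Ext.contravariant_sequence_exact₁ hS Y y (add_comm 1 n)
      (Subsingleton.elim _ _)
    have hz' : x • z = y := by
      have hz2 (z : Ext (ModuleCat.of A (A ⧸ P)) Y n) :
          (Ext.mk₀ (x • 𝟙 (ModuleCat.of A (A ⧸ P)))).comp z (zero_add n) = x • z := by
        rw [Ext.mk₀_smul, Ext.smul_comp, Ext.mk₀_id_comp]
      exact (hz2 z).symm.trans hz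
    rw [← hz']
    exact Submodule.smul_mem_smul hxm trivial
  have := Submodule.eq_bot_of_le_smul_of_le_jacobson_bot (maximalIdeal A) ⊤
    (Module.Finite.fg_top) hsurj (IsLocalRing.maximalIdeal_le_jacobson _)
  exact (Submodule.subsingleton_iff A).1 (subsingleton_of_bot_eq_top this.symm)

/-- In a short exact sequence, `Extⁿ(-, Y)` vanishes on the middle term when it vanishes on the
outer ones. -/
theorem subsingleton_ext_middle {S : ShortComplex (ModuleCat.{u} A)} (hS : S.ShortExact)
    (Y : ModuleCat.{u} A) (n : ℕ) (h₁ : Subsingleton (Ext S.X₁ Y n))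
    (h₃ : Subsingleton (Ext S.X₃ Y n)) : Subsingleton (Ext S.X₂ Y n) := by
  refine subsingleton_of_forall_eq 0 fun y => ?_
  obtain ⟨z, rfl⟩ := Ext.contravariant_sequence_exact₂ hS Y y (Subsingleton.elim _ _)
  rw [Subsingleton.elim z 0, Ext.comp_zero]

/-- In a short exact sequence, `Extⁿ(-, Y)` vanishes on the first term when it vanishes on the
middle one and `Extⁿ⁺¹(-, Y)` vanishes on the last one. -/
theorem subsingleton_ext_left {S : ShortComplex (ModuleCat.{u} A)} (hS : S.ShortExact)
    (Y : ModuleCat.{u} A) (n : ℕ) (h₂ : Subsingleton (Ext S.X₂ Y n))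
    (h₃ : Subsingleton (Ext S.X₃ Y (n + 1))) : Subsingleton (Ext S.X₁ Y n) := by
  refine subsingleton_of_forall_eq 0 fun y => ?_
  obtain ⟨z, rfl⟩ := Ext.contravariant_sequence_exact₁ hS Y y (add_comm 1 n)
    (Subsingleton.elim _ _)
  rw [Subsingleton.elim z 0, Ext.comp_zero]

/-- In a short exact sequence, `Extⁿ⁺¹(-, Y)` vanishes on the last term when it vanishes on the
middle one and `Extⁿ(-, Y)` vanishes on the first one. -/
theorem subsingleton_ext_right {S : ShortComplex (ModuleCat.{u} A)} (hS : S.ShortExact)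
    (Y : ModuleCat.{u} A) (n : ℕ) (h₁ : Subsingleton (Ext S.X₁ Y n))
    (h₂ : Subsingleton (Ext S.X₂ Y (n + 1))) : Subsingleton (Ext S.X₃ Y (n + 1)) := by
  refine subsingleton_of_forall_eq 0 fun y => ?_
  obtain ⟨z, rfl⟩ := Ext.contravariant_sequence_exact₃ hS Y y (Subsingleton.elim _ _)
    (add_comm 1 n)
  rw [Subsingleton.elim z 0, Ext.comp_zero]

theorem subsingleton_ext_of_iso {Z Z' : ModuleCat.{u} A} (e : Z ≅ Z') (Y : ModuleCat.{u} A) (n : ℕ)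
    (h : Subsingleton (Ext Z' Y n)) : Subsingleton (Ext Z Y n) := by
  refine subsingleton_of_forall_eq 0 fun y => ?_
  have h1 : (Ext.mk₀ e.inv).comp y (zero_add n) = 0 := Subsingleton.elim _ _
  have h2 : (Ext.mk₀ e.hom).comp ((Ext.mk₀ e.inv).comp y (zero_add n)) (zero_add n) = y := by
    rw [Ext.mk₀_comp_mk₀_assoc]
    simp
  rw [← h2, h1, Ext.comp_zero]

/-- If `Extⁿ(A/P, Y)` vanishes for all primes `P`, then `Extⁿ(Z, Y)` vanishes for all finitely
generated `Z`. -/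
theorem subsingleton_ext_of_forall_prime [IsNoetherianRing A] (Y : ModuleCat.{u} A) (n : ℕ)
    (h : ∀ P : Ideal A, P.IsPrime → Subsingleton (Ext (ModuleCat.of A (A ⧸ P)) Y n))
    (Z : ModuleCat.{u} A) (hZ : Module.Finite A Z) : Subsingleton (Ext Z Y n) := by
  refine IsNoetherianRing.induction_on_isQuotientEquivQuotientPrime (M := Z) A hZ
    (motive := fun N _ _ _ => Subsingleton (Ext (ModuleCat.of A N) Y n)) ?_ ?_ ?_
  · intro N _ _ _ _
    refine subsingleton_of_forall_eq 0 fun y => ?_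
    rw [← Ext.mk₀_id_comp y]
    have : 𝟙 (ModuleCat.of A N) = 0 := by
      ext x
      exact Subsingleton.elim (α := N) _ _
    rw [this, Ext.mk₀_zero, Ext.zero_comp]
  · intro N _ _ _ p e
    exact subsingleton_ext_of_iso e.toModuleIso Y n (h p.1 p.2)
  · intro N₁ _ _ _ N₂ _ _ _ N₃ _ _ _ f g hf hg hfg h₁ h₃
    exact subsingleton_ext_middle
      (ModuleCat.shortComplex_shortExact
        (ModuleCat.shortComplexOfCompEqZero f g hfg.linearMap_comp_eq_zero) hfg hf hg) Y n h₁ h₃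

/-- A noetherian local domain `A` with finite injective dimension in which the maximal ideal is
associated to a nonzero principal ideal `(b)`: every prime associated to `(b)` is maximal. -/
theorem eq_maximalIdeal_of_mem_associatedPrimes [IsDomain A] [IsLocalRing A] [IsNoetherianRing A]
    (n : ℕ) (hn : HasInjectiveDimensionLE (ModuleCat.of A A) n) (b : A) (hb : b ≠ 0)
    (hm : maximalIdeal A ∈ associatedPrimes A (A ⧸ Ideal.span {b}))
    (P : Ideal A) (hP : P ∈ associatedPrimes A (A ⧸ Ideal.span {b})) : P = maximalIdeal A := by
  let Y := ModuleCat.of A A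
  have hreg : IsSMulRegular Y b := by
    refine isSMulRegular_iff_right_eq_zero_of_smul.2 fun y hy => ?_
    have h1 : b * y = 0 := hy
    exact (mul_eq_zero.1 h1).resolve_left hb
  -- the sequence `0 → A → A → A / b → 0`
  let g : A →ₗ[A] A ⧸ Ideal.span {b} := (Ideal.span {b}).mkQ
  have hexact : Function.Exact (LinearMap.lsmul A A b) g := by
    intro x
    simp only [g, Submodule.mkQ_apply, Submodule.Quotient.mk_eq_zero, Ideal.mem_span_singleton']
    constructor
    · rintro ⟨c, rfl⟩
      exact ⟨c, mul_comm _ _⟩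
    · rintro ⟨c, rfl⟩
      exact ⟨c, mul_comm _ _⟩
  let S := ModuleCat.shortComplexOfCompEqZero (LinearMap.lsmul A A b) g
    hexact.linearMap_comp_eq_zero
  have hS : S.ShortExact :=
    ModuleCat.shortComplex_shortExact S hexact hreg (Submodule.mkQ_surjective _)
  have hfree : Projective Y := inferInstance
  have hAY (i : ℕ) : Subsingleton (Ext Y Y (i + 1)) := Ext.subsingleton_of_projective Y Y i
  have hX₃ (i : ℕ) : Subsingleton (Ext S.X₃ Y (i + 2)) :=
    subsingleton_ext_right hS Y (i + 1) (hAY i) (hAY (i + 1))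
  -- the sequence `0 → A / m → A / b → Q → 0`
  obtain ⟨-, f, hf⟩ := (isAssociatedPrime_iff_exists_injective_linearMap _ _).1 hm
  have hf' := f.exact_map_mkQ_range
  let T := ModuleCat.shortComplexOfCompEqZero f f.range.mkQ hf'.linearMap_comp_eq_zero
  have hT : T.ShortExact :=
    ModuleCat.shortComplex_shortExact T hf' hf (Submodule.mkQ_surjective _)
  have hTfin : Module.Finite A T.X₃ :=
    Module.Finite.of_surjective f.range.mkQ (Submodule.mkQ_surjective _)
  have hY : Module.Finite A Y := inferInstanceAs (Module.Finite A A)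
  -- Vanishing of `Ext` on finite modules descends one degree at a time, down to degree 2. Only the
  -- residue field escapes the Nakayama argument; it embeds in `A / b`, whose `Ext` vanishes from
  -- degree 2 on because its projective dimension is at most one.
  have descend (i : ℕ)
      (h : ∀ Z : ModuleCat.{u} A, Module.Finite A Z → Subsingleton (Ext Z Y (i + 3))) :
      ∀ Z : ModuleCat.{u} A, Module.Finite A Z → Subsingleton (Ext Z Y (i + 2)) := by
    refine subsingleton_ext_of_forall_prime Y (i + 2) fun P hP => ?_
    by_cases hPm : P = maximalIdeal A
    · subst hPm
      exact subsingleton_ext_left hT Y (i + 2) (hX₃ i) (h _ hTfin)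
    · exact subsingleton_ext_quotient_prime Y (i + 2) h P hPm
  have hall (j : ℕ) : (∀ Z : ModuleCat.{u} A, Module.Finite A Z →
      Subsingleton (Ext Z Y (j + 2))) →
      ∀ Z : ModuleCat.{u} A, Module.Finite A Z → Subsingleton (Ext Z Y 2) := by
    induction j with
    | zero => exact id
    | succ j ih => exact fun h => ih (descend j h)
  have h2 := hall n fun Z _ => HasInjectiveDimensionLT.subsingleton Y (n + 1) (n + 2) (by omega) Z
  by_contra hPm
  have hPprime : P.IsPrime := hP.isPrime
  have h1 := subsingleton_ext_quotient_prime Y 1 h2 P hPm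
  obtain ⟨-, φ, hφ⟩ := (isAssociatedPrime_iff_exists_injective_linearMap _ _).1 hP
  -- As `Ext¹(A/P, A) = 0`, the embedding `A/P → A/b` lifts to `A/P → A`. Such a map is zero because
  -- `b ∈ P` kills its source and `A` is a domain, a contradiction.
  obtain ⟨ψ, hψ⟩ := Ext.covariant_sequence_exact₃ (ModuleCat.of A (A ⧸ P)) hS
    (Ext.mk₀ (ModuleCat.ofHom φ)) (zero_add 1) (Subsingleton.elim _ _)
  obtain ⟨ψ, rfl⟩ := (Ext.mk₀_bijective _ _).2 ψ
  rw [Ext.mk₀_comp_mk₀, (Ext.mk₀_bijective _ _).1.eq_iff] at hψ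
  have hbP : b ∈ P := by
    have h0 : φ (Ideal.Quotient.mk P b) = 0 := by
      have : Ideal.Quotient.mk P b = b • (1 : A ⧸ P) := by
        rw [Algebra.smul_def, mul_one]; rfl
      rw [this, map_smul]
      obtain ⟨c, hc⟩ := Ideal.Quotient.mk_surjective (φ 1)
      rw [← hc]
      exact Ideal.Quotient.eq_zero_iff_mem.2 (Ideal.mul_mem_right _ _
        (Ideal.mem_span_singleton_self b))
    exact Ideal.Quotient.eq_zero_iff_mem.1 (hφ (h0.trans (map_zero φ).symm))
  have hψ0 : ψ.hom (1 : A ⧸ P) = (0 : A) := by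
    have h3 : b • ψ.hom (1 : A ⧸ P) = 0 := by
      rw [← map_smul]
      have : b • (1 : A ⧸ P) = 0 := by
        rw [Algebra.smul_def, mul_one]
        exact Ideal.Quotient.eq_zero_iff_mem.2 hbP
      rw [this, map_zero]
    exact (mul_eq_zero.1 h3).resolve_left hb
  have h4 : φ 1 = 0 := by
    have := congrArg (fun q => q.hom (1 : A ⧸ P)) hψ
    refine Eq.trans this.symm ?_
    change g (ψ.hom (1 : A ⧸ P)) = 0
    rw [hψ0, map_zero]
  exact one_ne_zero (hφ (h4.trans (map_zero φ).symm))

/-- A noetherian local domain with finite injective dimension in which the maximal ideal is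
associated to a nonzero principal ideal has dimension at most one. -/
theorem height_maximalIdeal_le_one [IsDomain A] [IsLocalRing A] [IsNoetherianRing A]
    (n : ℕ) (hn : HasInjectiveDimensionLE (ModuleCat.of A A) n) (b : A) (hb : b ≠ 0)
    (hm : maximalIdeal A ∈ associatedPrimes A (A ⧸ Ideal.span {b})) :
    (maximalIdeal A).height ≤ 1 := by
  have hne : Ideal.span {b} ≠ ⊤ := by
    intro h
    have : Subsingleton (A ⧸ Ideal.span {b}) := Ideal.Quotient.subsingleton_iff.2 h
    exact not_isAssociatedPrime_of_subsingleton hm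
  -- A minimal prime of `(b)` is associated, hence maximal by the previous lemma, and Krull's
  -- principal ideal theorem bounds its height.
  obtain ⟨q, hq⟩ := Ideal.nonempty_minimalPrimes hne
  have hq' : q ∈ associatedPrimes A (A ⧸ Ideal.span {b}) :=
    Module.associatedPrimes.minimalPrimes_annihilator_subset_associatedPrimes A _
      (by rwa [Ideal.annihilator_quotient])
  rw [eq_maximalIdeal_of_mem_associatedPrimes n hn b hb hm q hq'] at hq
  exact Ideal.height_le_one_of_isPrincipal_of_mem_minimalPrimes (Ideal.span {b}) _ hq

/-- In a noetherian domain all of whose localizations at primes have finite injective dimension,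
the primes associated to nonzero principal ideals have height at most one. -/
theorem height_le_one_of_mem_associatedPrimes [IsDomain A] [IsNoetherianRing A]
    (hG : ∀ (p : Ideal A) [p.IsPrime], ∃ n : ℕ,
      HasInjectiveDimensionLE
        (ModuleCat.of (Localization.AtPrime p) (Localization.AtPrime p)) n)
    (b : A) (hb : b ≠ 0) (P : Ideal A) (hP : P ∈ associatedPrimes A (A ⧸ Ideal.span {b})) :
    P.height ≤ 1 := by
  have hPp : P.IsPrime := hP.isPrime
  obtain ⟨-, x, hx⟩ := isAssociatedPrime_iff.1 hP
  obtain ⟨a, rfl⟩ := Ideal.Quotient.mk_surjective x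
  have hx' (r : A) : r ∈ P ↔ ∃ c, r * a = c * b := by
    rw [hx, Submodule.mem_colon_singleton, Submodule.mem_bot, Algebra.smul_def]
    change Ideal.Quotient.mk _ (r * a) = 0 ↔ _
    rw [Ideal.Quotient.eq_zero_iff_mem, Ideal.mem_span_singleton']
    exact ⟨fun ⟨c, h⟩ => ⟨c, h.symm⟩, fun ⟨c, h⟩ => ⟨c, h.symm⟩⟩
  let L := Localization.AtPrime P
  obtain ⟨n, hn⟩ := hG P
  have hinj : Function.Injective (algebraMap A L) :=
    IsLocalization.injective L P.primeCompl_le_nonZeroDivisors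
  have : IsDomain L := IsLocalization.isDomain_localization P.primeCompl_le_nonZeroDivisors
  have hb' : algebraMap A L b ≠ 0 := fun h => hb (hinj (h.trans (map_zero _).symm))
  -- If `P` is the annihilator of the class of `a` modulo `b`, the same description survives
  -- localization at `P`.
  have hm : maximalIdeal L ∈ associatedPrimes L (L ⧸ Ideal.span {algebraMap A L b}) := by
    refine isAssociatedPrime_iff.2
      ⟨inferInstance, Ideal.Quotient.mk _ (algebraMap A L a), Ideal.ext fun z => ?_⟩
    obtain ⟨r, s, rfl⟩ := IsLocalization.exists_mk'_eq P.primeCompl z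
    rw [IsLocalization.AtPrime.mk'_mem_maximal_iff L P, hx', Submodule.mem_colon_singleton,
      Submodule.mem_bot]
    change _ ↔ Ideal.Quotient.mk _ (IsLocalization.mk' L r s * algebraMap A L a) = 0
    rw [Ideal.Quotient.eq_zero_iff_mem, Ideal.mem_span_singleton']
    constructor
    · rintro ⟨c, hc⟩
      refine ⟨IsLocalization.mk' L c s, ?_⟩
      rw [mul_comm, IsLocalization.mul_mk'_eq_mk'_of_mul, mul_comm (IsLocalization.mk' L r s),
        IsLocalization.mul_mk'_eq_mk'_of_mul, mul_comm b, mul_comm a, hc]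
    · rintro ⟨c, hc⟩
      obtain ⟨c, t, rfl⟩ := IsLocalization.exists_mk'_eq P.primeCompl c
      rw [mul_comm, IsLocalization.mul_mk'_eq_mk'_of_mul, mul_comm (IsLocalization.mk' L r s),
        IsLocalization.mul_mk'_eq_mk'_of_mul, IsLocalization.mk'_eq_iff_eq, hinj.eq_iff] at hc
      rw [← hx']
      have ht : (t : A) * r ∈ P := (hx' _).2 ⟨s * c, by linear_combination -hc⟩
      exact (hPp.mem_or_mem ht).resolve_left t.2
  have := height_maximalIdeal_le_one n hn _ hb' hm
  rwa [← IsLocalization.height_under P.primeCompl, Localization.AtPrime.under_maximalIdeal] at this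

/-- In a noetherian domain all of whose localizations at primes have finite injective dimension,
an ideal `J` contained in no prime of height at most one satisfies `(J⁻¹ : J) = A`. -/
theorem dvd_of_forall_mem_dvd_mul [IsDomain A] [IsNoetherianRing A]
    (hG : ∀ (p : Ideal A) [p.IsPrime], ∃ n : ℕ,
      HasInjectiveDimensionLE
        (ModuleCat.of (Localization.AtPrime p) (Localization.AtPrime p)) n)
    (J : Ideal A) (hJ : ∀ P : Ideal A, P.IsPrime → P.height ≤ 1 → ¬ J ≤ P)
    (a b : A) (hb : b ≠ 0) (hab : ∀ x ∈ J, b ∣ x * a) : b ∣ a := by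
  by_contra h
  have hne : Ideal.Quotient.mk (Ideal.span {b}) a ≠ 0 := by
    rwa [Ne, Ideal.Quotient.eq_zero_iff_mem, Ideal.mem_span_singleton]
  -- The annihilator of the nonzero class of `a` contains `J` and is contained in an associated
  -- prime of `(b)`.
  obtain ⟨P, hP, hle⟩ := exists_le_isAssociatedPrime_of_isNoetherianRing A _ hne
  refine hJ P hP.isPrime (height_le_one_of_mem_associatedPrimes hG b hb P hP)
    (le_trans (fun x hx => ?_) hle)
  rw [Submodule.mem_colon_singleton, Submodule.mem_bot, Algebra.smul_def]
  change Ideal.Quotient.mk _ (x * a) = 0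
  rw [Ideal.Quotient.eq_zero_iff_mem, Ideal.mem_span_singleton]
  exact hab x hx

end GorensteinLocal

/-! ### Growth and primes of small height in affine domains -/

section AffineDomain

open MvPolynomial

variable {k : Type*} [Field k]

/-- Bounding the degree in each variable, rather than the total degree, makes the exponents a box,
and the count is a plain power. -/
theorem finrank_restrictDegree_le (d n : ℕ) :
    Module.finrank k (restrictDegree (Fin d) k n) ≤ (n + 1) ^ d := by
  have e : Module.finrank k (restrictDegree (Fin d) k n) =
      Nat.card {f : Fin d →₀ ℕ | ∀ a, f a ≤ n} :=
    Module.finrank_eq_nat_card_basis (basisRestrictSupport k {f : Fin d →₀ ℕ | ∀ a, f a ≤ n})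
  rw [e]
  have := Nat.card_le_card_of_injective
    (fun f : {f : Fin d →₀ ℕ | ∀ a, f a ≤ n} =>
      fun i : Fin d => (⟨f.1 i, Nat.lt_succ_of_le (f.2 i)⟩ : Fin (n + 1)))
    (fun f g h => Subtype.ext (Finsupp.ext fun i => by
      simpa using congrFun h i))
  simpa using this

theorem restrictDegree_mul_le (d m n : ℕ) :
    restrictDegree (Fin d) k m * restrictDegree (Fin d) k n ≤ restrictDegree (Fin d) k (m + n) := by
  rw [restrictDegree, restrictDegree, restrictDegree, ← restrictSupport_add]
  refine restrictSupport_mono _ ?_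
  rintro _ ⟨f, hf, g, hg, rfl⟩ i
  exact add_le_add (hf i) (hg i)

theorem exists_mem_restrictDegree (d : ℕ) (p : MvPolynomial (Fin d) k) :
    ∃ n, p ∈ restrictDegree (Fin d) k n :=
  ⟨p.totalDegree, restrictTotalDegree_le_restrictDegree _ _ _
    ((mem_restrictTotalDegree _ _ _).2 le_rfl)⟩

theorem restrictDegree_mono (d : ℕ) {m n : ℕ} (h : m ≤ n) :
    restrictDegree (Fin d) k m ≤ restrictDegree (Fin d) k n :=
  restrictSupport_mono _ fun _ hf i => (hf i).trans h

theorem finrank_mul_le {A : Type*} [CommRing A] [Algebra k A] (U V : Submodule k A)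
    [Module.Finite k U] [Module.Finite k V] :
    Module.finrank k (U * V : Submodule k A) ≤ Module.finrank k U * Module.finrank k V := by
  rw [← Submodule.mulMap_range, ← Module.finrank_tensorProduct]
  exact LinearMap.finrank_range_le _

variable (k) in
/-- The growth of a commutative algebra which is a finite module over a polynomial ring in `d`
variables is bounded by a polynomial of degree `d`. -/
theorem exists_finrank_pow_le {A : Type*} [CommRing A] [Algebra k A] {d : ℕ}
    (g : MvPolynomial (Fin d) k →ₐ[k] A) (hg : g.Finite) (W : Submodule k A) (hW : W.FG) :
    ∃ C : ℕ, ∀ n : ℕ, Module.finrank k (W ^ n : Submodule k A) ≤ C * (n + 1) ^ d := by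
  let _ : Algebra (MvPolynomial (Fin d) k) A := g.toRingHom.toAlgebra
  have hg' : Module.Finite (MvPolynomial (Fin d) k) A := hg
  obtain ⟨t, ht⟩ := hg'.1
  let V : Submodule k A := Submodule.span k (t : Set A)
  let G (n : ℕ) : Submodule k A := (restrictDegree (Fin d) k n).map g.toLinearMap
  have hGmono {m n : ℕ} (h : m ≤ n) : G m ≤ G n := Submodule.map_mono (restrictDegree_mono d h)
  have hGmul (m n : ℕ) : G m * G n ≤ G (m + n) := by
    rw [← Submodule.map_mul]
    exact Submodule.map_mono (restrictDegree_mul_le d m n)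
  -- every element lies in some `G n * V`
  have hex (a : A) : ∃ n, a ∈ G n * V := by
    have ha : a ∈ Submodule.span (MvPolynomial (Fin d) k) (t : Set A) := ht ▸ trivial
    induction ha using Submodule.span_induction with
    | mem x hx =>
      refine ⟨0, ?_⟩
      rw [← one_mul x]
      refine Submodule.mul_mem_mul ⟨1, ?_, map_one g⟩ (Submodule.subset_span hx)
      exact (mem_restrictDegree _ _ _).2 fun s hs i => by
        classical
        have : s = 0 := by
          by_contra h
          exact (mem_support_iff.1 hs) (by rw [coeff_one, if_neg (Ne.symm h)])
        simp [this]
    | zero => exact ⟨0, zero_mem _⟩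
    | add x y _ _ hx hy =>
      obtain ⟨m, hm⟩ := hx
      obtain ⟨n, hn⟩ := hy
      exact ⟨max m n, add_mem (mul_le_mul_left (hGmono (le_max_left m n)) V hm)
        (mul_le_mul_left (hGmono (le_max_right m n)) V hn)⟩
    | smul p x _ hx =>
      obtain ⟨m, hm⟩ := hx
      obtain ⟨n, hn⟩ := exists_mem_restrictDegree d p
      refine ⟨n + m, ?_⟩
      refine mul_le_mul_left (hGmul n m) V ?_
      rw [mul_assoc]
      exact Submodule.mul_mem_mul ⟨p, hn, rfl⟩ hm
  have hfg (U : Submodule k A) (hU : U.FG) : ∃ n, U ≤ G n * V := by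
    obtain ⟨s, rfl⟩ := hU
    choose N hN using hex
    refine ⟨s.sup N, Submodule.span_le.2 fun x hx => ?_⟩
    exact mul_le_mul_left (hGmono (Finset.le_sup (f := N) hx)) V (hN x)
  have hVfg : V.FG := ⟨t, rfl⟩
  -- Multiplying by `W` once costs at most `e` degrees of polynomial coefficients, so `Wⁿ` costs `n
  -- e`, plus `e₀` to reach `1`.
  obtain ⟨e, he⟩ := hfg (W * V) (hW.mul hVfg)
  obtain ⟨e₀, he₀⟩ := hfg 1 ⟨{1}, by rw [Submodule.one_eq_span]; simp⟩
  have hpow (n : ℕ) : W ^ n ≤ G (n * e + e₀) * V := by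
    induction n with
    | zero => simpa using he₀
    | succ n ih =>
      rw [pow_succ']
      calc W * W ^ n ≤ W * (G (n * e + e₀) * V) := mul_le_mul_right ih W
        _ = G (n * e + e₀) * (W * V) := by rw [mul_left_comm]
        _ ≤ G (n * e + e₀) * (G e * V) := mul_le_mul_right he _
        _ = (G (n * e + e₀) * G e) * V := by rw [mul_assoc]
        _ ≤ G (n * e + e₀ + e) * V := mul_le_mul_left (hGmul _ _) V
        _ = G ((n + 1) * e + e₀) * V := by congr 2; ring
  have hVfin : Module.Finite k V := Module.Finite.of_fg hVfg
  refine ⟨(e + e₀ + 1) ^ d * Module.finrank k V, fun n => ?_⟩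
  have hGfin (n : ℕ) : Module.Finite k (G n) := inferInstance
  have hGV : Module.Finite k (G (n * e + e₀) * V : Submodule k A) :=
    Module.Finite.of_fg ((Module.Finite.iff_fg.1 (hGfin _)).mul hVfg)
  calc Module.finrank k (W ^ n : Submodule k A)
      ≤ Module.finrank k (G (n * e + e₀) * V : Submodule k A) := Submodule.finrank_mono (hpow n)
    _ ≤ Module.finrank k (G (n * e + e₀)) * Module.finrank k V := finrank_mul_le _ _
    _ ≤ (n * e + e₀ + 1) ^ d * Module.finrank k V := by
        gcongr
        exact (Submodule.finrank_map_le _ _).trans (finrank_restrictDegree_le d _)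
    _ ≤ ((e + e₀ + 1) * (n + 1)) ^ d * Module.finrank k V := by
        gcongr
        nlinarith [Nat.zero_le (n * e₀), Nat.zero_le e]
    _ = (e + e₀ + 1) ^ d * Module.finrank k V * (n + 1) ^ d := by rw [mul_pow]; ring

/-- A prime of height at most one of a polynomial ring meets the polynomial ring in all but one of
the variables trivially. -/
theorem exists_rename_mem_imp_eq_zero (d : ℕ) (p : Ideal (MvPolynomial (Fin d) k)) [p.IsPrime]
    (hp : p.height ≤ 1) :
    ∃ e : Fin (d - 1) → Fin d, ∀ q : MvPolynomial (Fin (d - 1)) k, rename e q ∈ p → q = 0 := by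
  by_cases h0 : p = ⊥
  · have he : Function.Injective (Fin.castLE (Nat.sub_le d 1)) := Fin.castLE_injective _
    refine ⟨Fin.castLE (Nat.sub_le d 1), fun q hq => ?_⟩
    rw [h0, Ideal.mem_bot] at hq
    exact rename_injective _ he (hq.trans (map_zero _).symm)
  · obtain ⟨f, hfp, hf⟩ := Ideal.IsPrime.exists_mem_prime_of_ne_bot ‹_› h0
    have h1 : p.height = 1 := by
      refine le_antisymm hp (Order.one_le_iff_pos.2 (pos_iff_ne_zero.2 fun h => h0 ?_))
      exact Ideal.height_eq_zero_iff_eq_bot.1 h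
    have hpf := Ideal.eq_span_singleton_of_height_eq_one h1 hfp hf
    -- A height one prime of this UFD is generated by a prime element `f`. Omit a variable that
    -- occurs in `f`: degrees in it add, so it occurs in every nonzero multiple of `f`.
    obtain ⟨i, hi⟩ : ∃ i, i ∈ f.vars := by
      by_contra! H
      have hv : f.vars = ∅ := Finset.eq_empty_of_forall_notMem H
      have hc := vars_eq_empty_iff_eq_C.1 hv
      refine hf.not_isUnit ?_
      have h : f.coeff 0 ≠ 0 := by
        intro h
        rw [h, C_0] at hc
        exact hf.ne_zero hc
      rw [hc]
      exact (isUnit_iff_ne_zero.2 h).map C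
    obtain _ | d := d
    · exact i.elim0
    · refine ⟨i.succAbove, fun q hq => ?_⟩
      rw [hpf, Ideal.mem_span_singleton] at hq
      obtain ⟨h, hh⟩ := hq
      by_contra hq0
      have hr : rename i.succAbove q ≠ 0 := fun h' =>
        hq0 (rename_injective _ Fin.succAbove_right_injective (h'.trans (map_zero _).symm))
      have hh0 : h ≠ 0 := by
        rintro rfl
        exact hr (by rw [hh, mul_zero])
      have hpos (r : MvPolynomial (Fin (d + 1)) k) : 0 < degreeOf i r ↔ i ∈ r.vars := by
        rw [degreeOf_def, Multiset.count_pos, vars_def, Multiset.mem_toFinset]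
      have hdeg : degreeOf i (rename i.succAbove q) = degreeOf i f + degreeOf i h := by
        rw [hh, degreeOf_mul_eq hf.ne_zero hh0]
      have h2 : i ∈ (rename i.succAbove q).vars := by
        rw [← hpos, hdeg]
        exact Nat.add_pos_left ((hpos f).2 hi) _
      obtain ⟨j, -, hj⟩ := mem_vars_rename _ _ h2
      exact Fin.succAbove_ne i j hj

/-- In a domain which is a finite module over a polynomial ring in `d` variables, a prime of height
at most one admits `d - 1` elements which are algebraically independent modulo it. -/
theorem exists_aeval_mem_imp_eq_zero {A : Type*} [CommRing A] [IsDomain A] [Algebra k A] {d : ℕ}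
    (g : MvPolynomial (Fin d) k →ₐ[k] A) (hinj : Function.Injective g) (hg : g.Finite)
    (P : Ideal A) [P.IsPrime] (hP : P.height ≤ 1) :
    ∃ z : Fin (d - 1) → A, ∀ q : MvPolynomial (Fin (d - 1)) k, aeval z q ∈ P → q = 0 := by
  let _ : Algebra (MvPolynomial (Fin d) k) A := g.toRingHom.toAlgebra
  have hg' : Module.Finite (MvPolynomial (Fin d) k) A := hg
  have : FaithfulSMul (MvPolynomial (Fin d) k) A :=
    (faithfulSMul_iff_algebraMap_injective _ _).2 hinj
  have : IsNoetherianRing A := IsNoetherianRing.of_finite (MvPolynomial (Fin d) k) A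
  -- Going down holds because the polynomial ring is integrally closed; contraction therefore does
  -- not raise the height.
  have hgd : Algebra.HasGoingDown (MvPolynomial (Fin d) k) A := inferInstance
  let p : Ideal (MvPolynomial (Fin d) k) := P.under _
  have hp : p.height ≤ 1 := by
    refine le_trans ?_ hP
    rw [Ideal.height_eq_height_add_of_liesOver_of_hasGoingDown p P]
    exact le_self_add
  obtain ⟨e, he⟩ := exists_rename_mem_imp_eq_zero d p hp
  refine ⟨fun j => g (X (e j)), fun q hq => he q ?_⟩
  change g (rename e q) ∈ P
  have : g (rename e q) = aeval (fun j => g (X (e j))) q := by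
    rw [← AlgHom.comp_apply]
    congr 1
    ext j
    simp
  rwa [this]

end AffineDomain

/-! ### Symbols, and lifting divisibility from the associated graded ring -/

/-- A commutative model `A` of the associated graded algebra of a filtered algebra `R`: symbol maps
`Γₙ → A` with kernel `Γ_{n-1}` whose ranges are the components of a grading of `A`. -/
structure SymbolMap {k R : Type*} [Field k] [Ring R] [Algebra k R] (Γ : AlgFiltration k R)
    (A : Type*) [CommRing A] [Algebra k A] where
  symb (n : ℕ) : Γ.piece n →ₗ[k] A
  symb_mul {i j : ℕ} (a : Γ.piece i) (b : Γ.piece j) :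
    symb (i + j) ⟨a * b, Γ.mul_mem a.2 b.2⟩ = symb i a * symb j b
  symb_one : symb 0 ⟨1, Γ.one_mem⟩ = 1
  symb_eq_zero_iff {n : ℕ} (a : Γ.piece n) : symb n a = 0 ↔ (a : R) ∈ Γ.below n
  comp (n : ℕ) : A →ₗ[k] A
  comp_symb_same {n : ℕ} (a : Γ.piece n) : comp n (symb n a) = symb n a
  comp_symb_of_ne {m n : ℕ} (h : m ≠ n) (a : Γ.piece m) : comp n (symb m a) = 0
  span_eq_top : Submodule.span k {x | ∃ n a, symb n a = x} = ⊤

theorem AlgFiltration.exists_mem_notMem_below {k R : Type*} [Field k] [Ring R] [Algebra k R]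
    (Γ : AlgFiltration k R) {a : R} (ha : a ≠ 0) : ∃ n, a ∈ Γ.piece n ∧ a ∉ Γ.below n := by
  classical
  have h := Γ.exhaustive a
  refine ⟨Nat.find h, Nat.find_spec h, fun hb => ?_⟩
  rcases hn : Nat.find h with _ | n
  · rw [hn] at hb
    exact ha hb
  · rw [hn] at hb
    exact Nat.find_min h (m := n) (by omega) hb

theorem AlgFiltration.mem_below_of_lt {k R : Type*} [Field k] [Ring R] [Algebra k R]
    (Γ : AlgFiltration k R) {a : R} {m n : ℕ} (h : m < n) (ha : a ∈ Γ.piece m) :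
    a ∈ Γ.below n := by
  obtain _ | n := n
  · omega
  · exact Γ.mono (Nat.le_of_lt_succ h) ha

namespace SymbolMap

variable {k R : Type*} [Field k] [Ring R] [Algebra k R] {Γ : AlgFiltration k R}
  {A : Type*} [CommRing A] [Algebra k A] (σ : SymbolMap Γ A)

/-- The set of all symbols of elements of a subspace. -/
def symbSet (U : Submodule k R) : Set A := {x | ∃ n, ∃ a : Γ.piece n, (a : R) ∈ U ∧ σ.symb n a = x}

theorem induction_symb {p : A → Prop} (x : A) (symb : ∀ n a, p (σ.symb n a)) (zero : p 0)
    (add : ∀ x y, p x → p y → p (x + y)) : p x := by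
  have hx : x ∈ Submodule.span k {x | ∃ n a, σ.symb n a = x} := σ.span_eq_top ▸ trivial
  -- The predicate `p` need not be stable under scalars; carrying all scalars works because a
  -- multiple of a symbol is a symbol.
  suffices h : ∀ c : k, p (c • x) by simpa using h 1
  induction hx using Submodule.span_induction with
  | mem x hx =>
    obtain ⟨n, a, rfl⟩ := hx
    intro c
    rw [← map_smul]
    exact symb _ _
  | zero => intro c; rwa [smul_zero]
  | add x y _ _ hx hy => intro c; rw [smul_add]; exact add _ _ (hx c) (hy c)
  | smul a x _ hx => intro c; rw [smul_smul]; exact hx _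

theorem symb_congr {m n : ℕ} (h : m = n) (a : Γ.piece m) (b : Γ.piece n) (hab : (a : R) = b) :
    σ.symb m a = σ.symb n b := by
  subst h
  rw [Subtype.ext hab]

theorem exists_comp_eq (n : ℕ) (x : A) : ∃ a, σ.comp n x = σ.symb n a := by
  induction x using σ.induction_symb with
  | symb m a =>
    by_cases h : m = n
    · subst h
      exact ⟨a, σ.comp_symb_same a⟩
    · exact ⟨0, by rw [σ.comp_symb_of_ne h, map_zero]⟩
  | zero => exact ⟨0, by rw [map_zero, map_zero]⟩
  | add x y hx hy =>
    obtain ⟨a, ha⟩ := hx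
    obtain ⟨b, hb⟩ := hy
    exact ⟨a + b, by rw [map_add, map_add, ha, hb]⟩

/-- Multiplication by a homogeneous element shifts components. A quotient of two symbols can thus be
replaced by one of its components, which is again a symbol. -/
theorem comp_mul_symb (n : ℕ) (x : A) {m : ℕ} (b : Γ.piece m) :
    σ.comp (n + m) (x * σ.symb m b) = σ.comp n x * σ.symb m b := by
  induction x using σ.induction_symb with
  | symb l a =>
    rw [← σ.symb_mul]
    by_cases h : l = n
    · subst h
      rw [σ.comp_symb_same, σ.comp_symb_same, σ.symb_mul]
    · rw [σ.comp_symb_of_ne h, σ.comp_symb_of_ne (by omega), zero_mul]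
  | zero => simp
  | add x y hx hy => rw [add_mul, map_add, map_add, hx, hy, add_mul]

theorem comp_mul_symb_of_lt {n m : ℕ} (h : n < m) (x : A) (b : Γ.piece m) :
    σ.comp n (x * σ.symb m b) = 0 := by
  induction x using σ.induction_symb with
  | symb l a => rw [← σ.symb_mul, σ.comp_symb_of_ne (by omega)]
  | zero => simp
  | add x y hx hy => rw [add_mul, map_add, hx, hy, add_zero]

theorem symb_mul_mem {i j n : ℕ} (h : i + j = n) (a : Γ.piece i) (b : Γ.piece j) (c : Γ.piece n)
    (hc : (c : R) = a * b) : σ.symb n c = σ.symb i a * σ.symb j b := by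
  rw [← σ.symb_mul]
  exact σ.symb_congr h.symm _ _ hc

/-- If the symbol of `b` divides that of `a`, then `b` divides `a` on either side up to terms of
lower degree. -/
theorem exists_sub_mul_mem_below {m n : ℕ} (a : Γ.piece n) (b : Γ.piece m)
    (h : σ.symb m b ∣ σ.symb n a) :
    ∃ s : R, (a : R) - s * b ∈ Γ.below n ∧ (a : R) - b * s ∈ Γ.below n := by
  obtain ⟨c, hc⟩ := h
  rw [mul_comm] at hc
  have hcomp := congrArg (σ.comp n) hc
  rw [σ.comp_symb_same] at hcomp
  -- For `n < m` degree reasons make the symbol of `a` vanish, and `s = 0` serves.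
  by_cases hmn : n < m
  · rw [σ.comp_mul_symb_of_lt hmn, σ.symb_eq_zero_iff] at hcomp
    exact ⟨0, by simpa using hcomp, by simpa using hcomp⟩
  · obtain ⟨l, rfl⟩ := Nat.exists_eq_add_of_le' (not_lt.1 hmn)
    rw [σ.comp_mul_symb] at hcomp
    obtain ⟨s, hs⟩ := σ.exists_comp_eq l c
    rw [hs] at hcomp
    refine ⟨s, ?_, ?_⟩
    · have : σ.symb (l + m) (a - ⟨s * b, Γ.mul_mem s.2 b.2⟩) = 0 := by
        rw [map_sub, σ.symb_mul, hcomp, sub_self]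
      exact (σ.symb_eq_zero_iff _).1 this
    · have hbs : (b * s : R) ∈ Γ.piece (l + m) := by
        rw [add_comm]
        exact Γ.mul_mem b.2 s.2
      have : σ.symb (l + m) (a - ⟨b * s, hbs⟩) = 0 := by
        rw [map_sub, σ.symb_mul_mem (add_comm m l) b s ⟨b * s, hbs⟩ rfl, hcomp, mul_comm, sub_self]
      exact (σ.symb_eq_zero_iff _).1 this

/-- When `A` is a domain, the symbol of a multiple of `b` is divisible by the symbol of `b`. -/
theorem symb_dvd_of_eq_mul [IsDomain A] {m n : ℕ} (b : Γ.piece m) (hb : (b : R) ∉ Γ.below m)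
    (c : Γ.piece n) (s : R) (h : (c : R) = s * b ∨ (c : R) = b * s) :
    σ.symb m b ∣ σ.symb n c := by
  by_cases hs : s = 0
  · have : c = 0 := by
      ext
      simpa [hs] using h
    rw [this, map_zero]
    exact dvd_zero _
  obtain ⟨j, hj, hj'⟩ := Γ.exists_mem_notMem_below hs
  have hcm : (c : R) ∈ Γ.piece (j + m) := by
    rcases h with h | h
    · rw [h]; exact Γ.mul_mem hj b.2
    · rw [h, add_comm]; exact Γ.mul_mem b.2 hj
  have hprod : σ.symb (j + m) ⟨c, hcm⟩ = σ.symb j ⟨s, hj⟩ * σ.symb m b := by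
    rcases h with h | h
    · exact σ.symb_mul_mem rfl _ _ _ h
    · rw [mul_comm]
      exact σ.symb_mul_mem (add_comm m j) _ _ _ h
  have hne : σ.symb (j + m) ⟨c, hcm⟩ ≠ 0 := by
    rw [hprod]
    exact mul_ne_zero (fun h0 => hj' ((σ.symb_eq_zero_iff _).1 h0))
      (fun h0 => hb ((σ.symb_eq_zero_iff _).1 h0))
  -- The degree of `c` is exactly `j + m` since `A` is a domain, while `n` is only an upper bound: a
  -- larger `n` makes the symbol zero, and a smaller one is impossible.
  rcases lt_trichotomy (j + m) n with hlt | heq | hgt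
  · rw [(σ.symb_eq_zero_iff c).2 (Γ.mem_below_of_lt hlt hcm)]
    exact dvd_zero _
  · rw [← σ.symb_congr heq ⟨c, hcm⟩ c rfl, hprod]
    exact dvd_mul_left _ _
  · exact absurd ((σ.symb_eq_zero_iff _).2 (Γ.mem_below_of_lt hgt c.2)) hne

/-- If the symbols of `I` generate an ideal `J` of the associated graded domain with
`(J⁻¹ : J) = A`, then `I a ⊆ R b` implies `a ∈ R b`, and symmetrically. -/
theorem exists_eq_mul_of_forall_mem [IsDomain A] (I : Submodule k R)
    (hJ : ∀ a b : A, b ≠ 0 → (∀ x ∈ Ideal.span (σ.symbSet I), b ∣ x * a) → b ∣ a)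
    {b : R} (hb : b ≠ 0) (a : R) :
    ((∀ r ∈ I, ∃ s, r * a = s * b) → ∃ s, a = s * b) ∧
    ((∀ r ∈ I, ∃ s, a * r = b * s) → ∃ s, a = b * s) := by
  obtain ⟨m, hbm, hbm'⟩ := Γ.exists_mem_notMem_below hb
  have hb0 : σ.symb m ⟨b, hbm⟩ ≠ 0 := fun h0 => hbm' ((σ.symb_eq_zero_iff _).1 h0)
  -- the symbol of `b` divides that of `a`
  have key {n : ℕ} (a : R) (ha : a ∈ Γ.piece n)
      (h : (∀ r ∈ I, ∃ s, r * a = s * b) ∨ (∀ r ∈ I, ∃ s, a * r = b * s)) :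
      σ.symb m ⟨b, hbm⟩ ∣ σ.symb n ⟨a, ha⟩ := by
    refine hJ _ _ hb0 fun x hx => ?_
    induction hx using Submodule.span_induction with
    | mem x hx =>
      obtain ⟨l, r, hr, rfl⟩ := hx
      rcases h with h | h
      · obtain ⟨s, hs⟩ := h r hr
        rw [← σ.symb_mul]
        exact σ.symb_dvd_of_eq_mul ⟨b, hbm⟩ hbm' _ s (Or.inl hs)
      · obtain ⟨s, hs⟩ := h r hr
        rw [mul_comm, ← σ.symb_mul]
        exact σ.symb_dvd_of_eq_mul ⟨b, hbm⟩ hbm' _ s (Or.inr hs)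
    | zero => rw [zero_mul]; exact dvd_zero _
    | add x y _ _ hx hy => rw [add_mul]; exact dvd_add hx hy
    | smul c x _ hx => rw [smul_eq_mul, mul_assoc]; exact Dvd.dvd.mul_left hx c
  -- Subtracting the multiple of `b` found on symbols lowers the degree of `a` and preserves the
  -- hypothesis, as the subtracted term is itself a multiple of `b`.
  obtain ⟨n, hn⟩ := Γ.exhaustive a
  induction n generalizing a with
  | zero =>
    constructor
    · intro h
      obtain ⟨s, hs, -⟩ := σ.exists_sub_mul_mem_below ⟨a, hn⟩ ⟨b, hbm⟩ (key a hn (Or.inl h))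
      exact ⟨s, sub_eq_zero.1 hs⟩
    · intro h
      obtain ⟨s, -, hs⟩ := σ.exists_sub_mul_mem_below ⟨a, hn⟩ ⟨b, hbm⟩ (key a hn (Or.inr h))
      exact ⟨s, sub_eq_zero.1 hs⟩
  | succ n ih =>
    constructor
    · intro h
      obtain ⟨s, hs, -⟩ := σ.exists_sub_mul_mem_below ⟨a, hn⟩ ⟨b, hbm⟩ (key a hn (Or.inl h))
      obtain ⟨s', hs'⟩ := (ih (a - s * b) hs).1 fun r hr => by
        obtain ⟨t, ht⟩ := h r hr
        exact ⟨t - r * s, by rw [mul_sub, ht, sub_mul, mul_assoc]⟩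
      exact ⟨s' + s, by rw [add_mul, ← hs', sub_add_cancel]⟩
    · intro h
      obtain ⟨s, -, hs⟩ := σ.exists_sub_mul_mem_below ⟨a, hn⟩ ⟨b, hbm⟩ (key a hn (Or.inr h))
      obtain ⟨s', hs'⟩ := (ih (a - b * s) hs).2 fun r hr => by
        obtain ⟨t, ht⟩ := h r hr
        exact ⟨t - s * r, by rw [sub_mul, ht, mul_sub, mul_assoc]⟩
      exact ⟨s' + s, by rw [mul_add, ← hs', sub_add_cancel]⟩

theorem symbSet_mono {U V : Submodule k R} (h : U ≤ V) : σ.symbSet U ⊆ σ.symbSet V := by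
  rintro x ⟨n, a, ha, rfl⟩
  exact ⟨n, a, h ha, rfl⟩

/-- Leading terms can cancel in sums of products, so `U * V` may have further symbols. This
inclusion is the one needed to bound growth from below. -/
theorem span_symbSet_mul_le (U V : Submodule k R) :
    Submodule.span k (σ.symbSet U) * Submodule.span k (σ.symbSet V) ≤
      Submodule.span k (σ.symbSet (U * V)) := by
  rw [Submodule.span_mul_span]
  refine Submodule.span_mono ?_
  rintro _ ⟨_, ⟨i, a, ha, rfl⟩, _, ⟨j, b, hb, rfl⟩, rfl⟩
  exact ⟨i + j, _, Submodule.mul_mem_mul ha hb, σ.symb_mul a b⟩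

theorem one_mem_symbSet {U : Submodule k R} (h : 1 ∈ U) : 1 ∈ σ.symbSet U :=
  ⟨0, ⟨1, Γ.one_mem⟩, h, σ.symb_one⟩

theorem span_symbSet_pow_le {U : Submodule k R} (n : ℕ) :
    Submodule.span k (σ.symbSet U) ^ n ≤ Submodule.span k (σ.symbSet (U ^ n)) := by
  induction n with
  | zero =>
    rw [pow_zero, pow_zero, Submodule.one_le]
    exact Submodule.subset_span (σ.one_mem_symbSet (Submodule.one_le.1 le_rfl))
  | succ n ih =>
    rw [pow_succ, pow_succ]
    exact (mul_le_mul_left ih _).trans (σ.span_symbSet_mul_le _ _)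

theorem exists_fg_mem_span_symbSet (x : A) :
    ∃ V : Submodule k R, V.FG ∧ x ∈ Submodule.span k (σ.symbSet V) := by
  induction x using σ.induction_symb with
  | symb n a =>
    exact ⟨Submodule.span k {(a : R)}, Submodule.fg_span_singleton _,
      Submodule.subset_span ⟨n, a, Submodule.mem_span_singleton_self _, rfl⟩⟩
  | zero => exact ⟨⊥, Submodule.fg_bot, zero_mem _⟩
  | add x y hx hy =>
    obtain ⟨U, hU, hxU⟩ := hx
    obtain ⟨V, hV, hyV⟩ := hy
    exact ⟨U ⊔ V, hU.sup hV,
      add_mem (Submodule.span_mono (σ.symbSet_mono le_sup_left) hxU)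
        (Submodule.span_mono (σ.symbSet_mono le_sup_right) hyV)⟩

/-- Elements with symbols linearly independent modulo an ideal containing the symbols of
`ker f` have linearly independent images under `f`. -/
theorem linearIndependent_map {B : Type*} [AddCommGroup B] [Module k B] (f : R →ₗ[k] B) (P : Ideal A)
    (hP : σ.symbSet (LinearMap.ker f) ⊆ P)
    {ι : Type*} (e : ι → ℕ) (u : ∀ i, Γ.piece (e i))
    (h : LinearIndependent k fun i => Ideal.Quotient.mkₐ k P (σ.symb (e i) (u i))) :
    LinearIndependent k fun i => f (u i : R) := by
  classical
  rw [linearIndependent_iff'] at h ⊢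
  intro s g hg
  by_contra! H
  obtain ⟨i₀, hi₀, hgi₀⟩ := H
  let s' := s.filter fun i => g i ≠ 0
  obtain ⟨i₁, hi₁, hmax⟩ := s'.exists_max_image e ⟨i₀, Finset.mem_filter.2 ⟨hi₀, hgi₀⟩⟩
  -- In the top degree `D` among the terms with nonzero coefficient, the symbol of the relation sees
  -- only the terms of degree exactly `D`, and gives a forbidden relation modulo `P`.
  let D := e i₁
  have hpiece (i : ι) (hi : i ∈ s') : (u i : R) ∈ Γ.piece D := Γ.mono (hmax i hi) (u i).2
  let v (i : ι) : Γ.piece D := if hi : (u i : R) ∈ Γ.piece D then ⟨u i, hi⟩ else 0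
  have hv (i : ι) (hi : i ∈ s') : (v i : R) = u i := by
    simp only [v, dif_pos (hpiece i hi)]
  have hsum : ((∑ i ∈ s', g i • v i : Γ.piece D) : R) ∈ LinearMap.ker f := by
    have h1 : ((∑ i ∈ s', g i • v i : Γ.piece D) : R) = ∑ i ∈ s', g i • (u i : R) := by
      rw [AddSubmonoidClass.coe_finsetSum]
      exact Finset.sum_congr rfl fun i hi => by rw [Submodule.coe_smul, hv i hi]
    have h2 : ∑ i ∈ s', g i • (u i : R) = ∑ i ∈ s, g i • (u i : R) :=
      Finset.sum_filter_of_ne fun i _ hi h0 => hi (by rw [h0, zero_smul])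
    rw [h1, h2, LinearMap.mem_ker, map_sum]
    simpa only [map_smul] using hg
  have hmem : σ.symb D (∑ i ∈ s', g i • v i) ∈ P := hP ⟨D, _, hsum, rfl⟩
  have hsymb : σ.symb D (∑ i ∈ s', g i • v i) =
      ∑ i ∈ s'.filter (fun i => e i = D), g i • σ.symb (e i) (u i) := by
    rw [map_sum, Finset.sum_filter (fun i => e i = D)]
    refine Finset.sum_congr rfl fun i hi => ?_
    rw [map_smul]
    split_ifs with hD
    · congr 1
      exact σ.symb_congr hD.symm _ _ (hv i hi)
    · rw [(σ.symb_eq_zero_iff (v i)).2, smul_zero]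
      rw [hv i hi]
      exact Γ.mem_below_of_lt (lt_of_le_of_ne (hmax i hi) hD) (u i).2
  have h0 : ∑ i ∈ s'.filter (fun i => e i = D),
      g i • Ideal.Quotient.mkₐ k P (σ.symb (e i) (u i)) = 0 := by
    rw [hsymb] at hmem
    have := Ideal.Quotient.eq_zero_iff_mem.2 hmem
    rw [← Ideal.Quotient.mkₐ_eq_mk k, map_sum] at this
    simpa only [map_smul] using this
  exact (Finset.mem_filter.1 hi₁).2 (h _ g h0 i₁ (Finset.mem_filter.2 ⟨hi₁, rfl⟩))

/-- The image under `f` of a finite dimensional space `U` has at least as large a dimension as the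
image modulo `P` of the span of its symbols, if `P` contains the symbols of `ker f`. -/
theorem card_le_finrank_map {B : Type*} [AddCommGroup B] [Module k B] (f : R →ₗ[k] B)
    (U : Submodule k R) (hU : U.FG) (P : Ideal A) (hP : σ.symbSet (LinearMap.ker f) ⊆ P) {ι : Type*} [Fintype ι] (z : ι → A)
    (hz : ∀ i, z i ∈ Submodule.span k (σ.symbSet U))
    (hli : LinearIndependent k fun i => Ideal.Quotient.mkₐ k P (z i)) :
    Fintype.card ι ≤ Module.finrank k (U.map f) := by
  -- The `z i` are only combinations of symbols. A basis of the image that consists of classes of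
  -- genuine symbols can be lifted to `U`.
  obtain ⟨T, hTS, hTspan, hT⟩ :=
    exists_linearIndependent k (Ideal.Quotient.mkₐ k P '' σ.symbSet U)
  have hex (b : T) : ∃ n, ∃ a : Γ.piece n, (a : R) ∈ U ∧
      Ideal.Quotient.mkₐ k P (σ.symb n a) = b := by
    obtain ⟨_, ⟨n, a, ha, rfl⟩, h⟩ := hTS b.2
    exact ⟨n, a, ha, h⟩
  choose e u huU hu using hex
  have hli' : LinearIndependent k fun b : T => f (u b : R) :=
    σ.linearIndependent_map f P hP e u (by simpa only [hu] using hT)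
  let w (b : T) : U.map f := ⟨f (u b : R), Submodule.mem_map_of_mem (huU b)⟩
  have hw : LinearIndependent k w := LinearIndependent.of_comp (U.map f).subtype hli'
  have : Module.Finite k (U.map f) := Module.Finite.of_fg (hU.map _)
  have hfin : Finite T := hw.finite_of_isNoetherian
  have : Fintype T := Fintype.ofFinite T
  refine le_trans ?_ hw.fintype_card_le_finrank
  let y (i : ι) : Submodule.span k T := ⟨Ideal.Quotient.mkₐ k P (z i), by
    rw [hTspan]
    have := Submodule.mem_map_of_mem (f := (Ideal.Quotient.mkₐ k P).toLinearMap) (hz i)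
    rwa [Submodule.map_span] at this⟩
  have hy : LinearIndependent k y := LinearIndependent.of_comp (Submodule.span k T).subtype hli
  have : Module.Finite k (Submodule.span k T) := Module.Finite.span_of_finite k T.toFinite
  refine hy.fintype_card_le_finrank.trans ?_
  exact finrank_span_le_card T |>.trans (by rw [Set.toFinset_card])

end SymbolMap

/-! ### Gelfand–Kirillov dimension from polynomial growth bounds -/

section GKDim

open Filter Topology

theorem ENNReal.log_natCast {n : ℕ} (hn : 0 < n) :
    ENNReal.log (n : ENNReal) = ((Real.log n : ℝ) : EReal) := by
  have h := ENNReal.log_ofReal_of_pos (x := (n : ℝ)) (by exact_mod_cast hn)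
  rwa [ENNReal.ofReal_natCast] at h

theorem tendsto_mul_add_log_div_log (d : ℕ) (c : ℝ) :
    Tendsto (fun n : ℕ => (d * Real.log n + c) / Real.log n) atTop (𝓝 d) := by
  have h1 : Tendsto (fun n : ℕ => Real.log n) atTop atTop :=
    Real.tendsto_log_atTop.comp tendsto_natCast_atTop_atTop
  have h2 : Tendsto (fun n : ℕ => d + c / Real.log n) atTop (𝓝 (d + 0)) :=
    tendsto_const_nhds.add (h1.const_div_atTop c)
  rw [add_zero] at h2
  refine h2.congr' ?_
  filter_upwards [h1.eventually_gt_atTop 0] with n hn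
  field_simp

theorem tendsto_mul_log_div_log_add (d : ℕ) (c : ℝ) :
    Tendsto (fun n : ℕ => d * Real.log n / (c + Real.log n)) atTop (𝓝 d) := by
  have h1 : Tendsto (fun n : ℕ => Real.log n) atTop atTop :=
    Real.tendsto_log_atTop.comp tendsto_natCast_atTop_atTop
  have h1' : Tendsto (fun n : ℕ => c + Real.log n) atTop atTop :=
    tendsto_atTop_add_const_left _ c h1
  have h2 : Tendsto (fun n : ℕ => d - d * c / (c + Real.log n)) atTop (𝓝 (d - 0)) :=
    tendsto_const_nhds.sub (h1'.const_div_atTop _)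
  rw [sub_zero] at h2
  refine h2.congr' ?_
  filter_upwards [h1'.eventually_gt_atTop 0] with n hn
  field_simp
  ring

variable {k B : Type*} [Field k] [Ring B] [Algebra k B]

theorem gkDim_le (d : ℕ)
    (h : ∀ V : Submodule k B, V.FG →
      ∃ C : ℕ, ∀ n : ℕ, Module.finrank k ((1 ⊔ V) ^ n : Submodule k B) ≤ C * (n + 1) ^ d) :
    gkDim k B ≤ d := by
  refine iSup_le fun V => ?_
  obtain ⟨C, hC⟩ := h V.1 V.2
  have hlim : Tendsto (fun n : ℕ =>
      (((d * Real.log n + Real.log ((C + 1) * 2 ^ d)) / Real.log n : ℝ) : EReal)) atTop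
      (𝓝 ((d : ℝ) : EReal)) :=
    (continuous_coe_real_ereal.tendsto _).comp (tendsto_mul_add_log_div_log d _)
  refine le_trans (limsup_le_limsup ?_) hlim.limsup_eq.le
  filter_upwards [eventually_ge_atTop 1] with n hn
  rw [EReal.coe_div]
  refine EReal.div_le_div_right_of_nonneg
    (by exact_mod_cast Real.log_nonneg (by exact_mod_cast hn)) ?_
  -- For `n ≥ 1` one has `n + 1 ≤ 2 n`; the constant `C + 1` is positive, so its logarithm is
  -- harmless.
  have hle : Module.finrank k ((1 ⊔ V.1) ^ n : Submodule k B) ≤ (C + 1) * 2 ^ d * n ^ d := by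
    refine (hC n).trans ?_
    rw [mul_assoc, ← mul_pow]
    gcongr <;> omega
  refine (ENNReal.log_le_log (Nat.cast_le.2 hle)).trans ?_
  rw [ENNReal.log_natCast (by positivity), EReal.coe_le_coe_iff]
  have hn0 : (n : ℝ) ≠ 0 := by positivity
  push_cast
  rw [Real.log_mul (by positivity) (by positivity), Real.log_pow, add_comm]

/-- The limsup dominates the limsup along `n = (d + 1) m`, where the factor `d + 1` only adds a
constant to `log n`. Using `d + 1` instead of `d` keeps the subsequence unbounded when `d = 0`. -/
theorem le_gkDim (V : Submodule k B) (hV : V.FG) (d : ℕ)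
    (h : ∀ m : ℕ, (m + 1) ^ d ≤
      Module.finrank k ((1 ⊔ V) ^ ((d + 1) * m) : Submodule k B)) :
    (d : EReal) ≤ gkDim k B := by
  refine le_trans ?_ (le_iSup _ (⟨V, hV⟩ : {V : Submodule k B // V.FG}))
  have hlim : Tendsto (fun n : ℕ =>
      ((d * Real.log n / (Real.log (d + 1) + Real.log n) : ℝ) : EReal)) atTop
      (𝓝 ((d : ℝ) : EReal)) :=
    (continuous_coe_real_ereal.tendsto _).comp (tendsto_mul_log_div_log_add d _)
  have hmap : Tendsto (fun m : ℕ => (d + 1) * m) atTop atTop :=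
    tendsto_id.const_mul_atTop' d.succ_pos
  refine le_trans (le_of_eq hlim.limsup_eq.symm) ?_
  refine le_trans ?_ (limsup_le_limsup_of_le hmap)
  rw [← limsup_comp]
  refine limsup_le_limsup ?_
  filter_upwards [eventually_ge_atTop 1] with m hm
  have hm0 : (0 : ℝ) < m := by exact_mod_cast hm
  have hlog : Real.log ((d + 1 : ℕ) * m : ℕ) = Real.log (d + 1) + Real.log m := by
    push_cast
    rw [Real.log_mul (by positivity) (by positivity)]
  simp only [Function.comp_apply]
  rw [hlog, EReal.coe_div]
  refine EReal.div_le_div_right_of_nonneg ?_ ?_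
  · rw [← hlog]
    exact_mod_cast Real.log_natCast_nonneg _
  · refine le_trans ?_ (ENNReal.log_le_log (Nat.cast_le.2
      (le_trans (Nat.pow_le_pow_left m.le_succ d) (h m))))
    rw [ENNReal.log_natCast (by positivity), EReal.coe_le_coe_iff]
    push_cast
    rw [Real.log_pow]

end GKDim

/-! ### Lower bound for the dimension of a quotient -/

namespace SymbolMap

open MvPolynomial

variable {k R : Type*} [Field k] [Ring R] [Algebra k R] {Γ : AlgFiltration k R}
  {A : Type*} [CommRing A] [Algebra k A] (σ : SymbolMap Γ A)

/-- If `A` contains `d` elements which are algebraically independent modulo an ideal containing the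
symbols of `I`, then `R / I` has Gelfand-Kirillov dimension at least `d`. -/
theorem le_gkDim_quotient (I : Ideal R) [I.IsTwoSided] (P : Ideal A)
    (hP : σ.symbSet (I.restrictScalars k) ⊆ P) (d : ℕ) (z : Fin d → A)
    (hz : ∀ q : MvPolynomial (Fin d) k, aeval z q ∈ P → q = 0) :
    (d : EReal) ≤ gkDim k (R ⧸ I) := by
  -- The `z i` need not be homogeneous; each is a combination of symbols from a finite dimensional
  -- subspace of `R`.
  choose V hVfg hV using fun i => σ.exists_fg_mem_span_symbSet (z i)
  let U : Submodule k R := ⨆ i, V i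
  have hU : U.FG := Submodule.fg_iSup _ hVfg
  let f : R →ₐ[k] R ⧸ I := Ideal.Quotient.mkₐ k I
  refine le_gkDim (U.map f.toLinearMap) (hU.map _) d fun m => ?_
  have hmap : (1 ⊔ U.map f.toLinearMap) ^ ((d + 1) * m) =
      ((1 ⊔ U) ^ ((d + 1) * m)).map f.toLinearMap := by
    rw [Submodule.map_pow, Submodule.map_sup, Submodule.map_one]
  have h1fg : (1 ⊔ U).FG := Submodule.FG.sup ⟨{1}, by rw [Submodule.one_eq_span]; simp⟩ hU
  let W : Submodule k A := Submodule.span k (σ.symbSet (1 ⊔ U))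
  have hzW (i : Fin d) : z i ∈ W :=
    Submodule.span_mono (σ.symbSet_mono ((le_iSup V i).trans le_sup_right)) (hV i)
  have h1W : 1 ∈ W :=
    Submodule.subset_span (σ.one_mem_symbSet (le_sup_left (a := 1) (b := U)
      (Submodule.one_le.1 le_rfl)))
  have h1W' : 1 ≤ W := Submodule.one_le.2 h1W
  -- the monomials in `z` with exponents at most `m`
  let mon (α : Fin d → Fin (m + 1)) : A := ∏ i, z i ^ (α i : ℕ)
  have hmonW (α : Fin d → Fin (m + 1)) : mon α ∈ W ^ ((d + 1) * m) := by
    have h1 (s : Finset (Fin d)) : ∏ i ∈ s, z i ^ (α i : ℕ) ∈ (W ^ m) ^ s.card := by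
      induction s using Finset.cons_induction with
      | empty => exact Submodule.one_le.1 le_rfl
      | cons i s hi ih =>
        rw [Finset.prod_cons, Finset.card_cons, pow_succ']
        exact Submodule.mul_mem_mul (pow_le_pow_right₀ h1W' (Nat.le_of_lt_succ (α i).2)
          (Submodule.pow_mem_pow _ (hzW i) _)) ih
    replace h1 := h1 Finset.univ
    rw [Finset.card_univ, Fintype.card_fin, ← pow_mul] at h1
    exact pow_le_pow_right₀ h1W' (by nlinarith) h1
  have hli : LinearIndependent k fun α => Ideal.Quotient.mkₐ k P (mon α) := by
    let e (α : Fin d → Fin (m + 1)) : Fin d →₀ ℕ := Finsupp.equivFunOnFinite.symm fun i => (α i : ℕ)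
    have he : Function.Injective e := fun α β h => by
      funext i
      have := DFunLike.congr_fun h i
      exact Fin.ext this
    have h1 : LinearIndependent k fun α => (monomial (e α) (1 : k) : MvPolynomial (Fin d) k) :=
      (basisMonomials (Fin d) k).linearIndependent.comp e he
    let φ : MvPolynomial (Fin d) k →ₐ[k] A ⧸ P := (Ideal.Quotient.mkₐ k P).comp (aeval z)
    have h2 := h1.map' φ.toLinearMap (LinearMap.ker_eq_bot'.2 fun q hq =>
      hz q (Ideal.Quotient.eq_zero_iff_mem.1 hq))
    have h3 : (fun α => Ideal.Quotient.mkₐ k P (mon α)) =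
        φ.toLinearMap ∘ fun α => (monomial (e α) (1 : k) : MvPolynomial (Fin d) k) := by
      funext α
      change _ = Ideal.Quotient.mkₐ k P (aeval z (monomial (e α) 1))
      rw [aeval_monomial, map_one, one_mul, Finsupp.prod_fintype _ _ fun i => pow_zero _]
      rfl
    rw [h3]
    exact h2
  have hker : LinearMap.ker f.toLinearMap = I.restrictScalars k := by
    ext x
    exact Ideal.Quotient.eq_zero_iff_mem
  have := σ.card_le_finrank_map f.toLinearMap ((1 ⊔ U) ^ ((d + 1) * m)) (h1fg.pow _) P
    (hker ▸ hP) mon (fun α => σ.span_symbSet_pow_le _ (hmonW α)) hli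
  rw [hmap]
  simpa using this

end SymbolMap

/-! ### Rewriting words in almost commuting letters -/

section Words

variable {k R ι O : Type*} [Field k] [Ring R] [Algebra k R] [LinearOrder O]

variable (k) in
/-- The span of the words in the letters `a i` which satisfy `p`. -/
def wordSpan (a : ι → R) (p : List ι → Prop) : Submodule k R :=
  Submodule.span k ((fun l : List ι => (l.map a).prod) '' {l | p l})

theorem wordSpan_mono (a : ι → R) {p q : List ι → Prop} (h : ∀ l, p l → q l) :
    wordSpan k a p ≤ wordSpan k a q :=
  Submodule.span_mono (Set.image_mono h)

theorem word_mem_wordSpan (a : ι → R) {p : List ι → Prop} {l : List ι} (h : p l) :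
    (l.map a).prod ∈ wordSpan k a p :=
  Submodule.subset_span ⟨l, h, rfl⟩

theorem wordSpan_le (a : ι → R) {p : List ι → Prop} {U : Submodule k R}
    (h : ∀ l, p l → (l.map a).prod ∈ U) : wordSpan k a p ≤ U := by
  refine Submodule.span_le.2 ?_
  rintro _ ⟨l, hl, rfl⟩
  exact h l hl

theorem word_mul_mem_wordSpan (a : ι → R) {p q : List ι → Prop} {y : R}
    (hy : y ∈ wordSpan k a p) (l l' : List ι) (h : ∀ t, p t → q (l ++ t ++ l')) :
    (l.map a).prod * y * (l'.map a).prod ∈ wordSpan k a q := by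
  induction hy using Submodule.span_induction with
  | mem y hy =>
    obtain ⟨t, ht, rfl⟩ := hy
    have := word_mem_wordSpan (k := k) a (h t ht)
    simpa [mul_assoc] using this
  | zero => simp
  | add x y _ _ hx hy => rw [mul_add, add_mul]; exact add_mem hx hy
  | smul c x _ hx =>
    rw [mul_smul_comm, smul_mul_assoc]
    exact Submodule.smul_mem _ c hx

/-- If commutators of letters have lower weight, then a word depends only on its multiset of letters
up to terms of lower weight. -/
theorem word_sub_word_mem_of_perm (a : ι → R) (ω : ι → ℕ)
    (hcomm : ∀ i j, a i * a j - a j * a i ∈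
      wordSpan k a fun l => (l.map ω).sum < ω i + ω j)
    {l l' : List ι} (h : l.Perm l') :
    (l.map a).prod - (l'.map a).prod ∈ wordSpan k a fun t => (t.map ω).sum < (l.map ω).sum := by
  induction h with
  | nil => simp
  | cons i h ih =>
    have := word_mul_mem_wordSpan a (q := fun t => (t.map ω).sum < ω i + (_ : ℕ)) ih [i] []
      (fun t ht => by simpa using ht)
    simpa [mul_sub] using this
  | swap i j l =>
    have := word_mul_mem_wordSpan a (q := fun t => (t.map ω).sum < ω j + (ω i + (l.map ω).sum))
      (hcomm j i) [] l (fun t ht => by simp; omega)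
    simpa [sub_mul, mul_assoc] using this
  | trans h₁ h₂ ih₁ ih₂ =>
    rw [← (h₁.map ω).sum_eq] at ih₂
    simpa using add_mem ih₁ ih₂

/-- Suppose that commutators of letters have lower weight, and that every reducible multiset
contains one whose word can be rewritten in terms of words which have lower weight or are smaller.
Then every word is a linear combination of irreducible words of at most the same weight. -/
theorem word_mem_wordSpan_irreducible [WellFoundedLT O] (a : ι → R) (ω : ι → ℕ)
    (hcomm : ∀ i j, a i * a j - a j * a i ∈
      wordSpan k a fun l => (l.map ω).sum < ω i + ω j)
    (key : Multiset ι → O) (hadd : ∀ s t u, key s < key t → key (s + u) < key (t + u))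
    (Red : Set (Multiset ι))
    (hred : ∀ s ∈ Red, ∃ f ≤ s, (f.toList.map a).prod ∈
      wordSpan k a fun l => (l.map ω).sum < (f.toList.map ω).sum ∨
        ((l.map ω).sum ≤ (f.toList.map ω).sum ∧ key l < key f)) (l : List ι) :
    (l.map a).prod ∈ wordSpan k a fun t =>
      (∃ s ∉ Red, t = s.toList) ∧ (t.map ω).sum ≤ (l.map ω).sum := by
  -- Outer induction on the weight bound absorbs reordering and lower terms; inner induction on
  -- `key` absorbs the rewriting of a reducible factor.
  suffices h : ∀ n : ℕ, ∀ l : List ι, (l.map ω).sum ≤ n → (l.map a).prod ∈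
      wordSpan k a fun t => (∃ s ∉ Red, t = s.toList) ∧ (t.map ω).sum ≤ n from h _ l le_rfl
  intro n
  induction n using Nat.strong_induction_on with
  | _ n ihn =>
    intro l
    generalize hκ : key l = κ
    induction κ using WellFoundedLT.induction generalizing l with
    | _ κ ihκ =>
      subst hκ
      intro hl
      set H := wordSpan k a fun t => (∃ s ∉ Red, t = s.toList) ∧ (t.map ω).sum ≤ n with hH
      have hlow : (wordSpan k a fun t => (t.map ω).sum < (l.map ω).sum) ≤ H := by
        refine wordSpan_le a fun t ht => ?_
        exact wordSpan_mono a (fun _ h => ⟨h.1, by omega⟩) (ihn _ (ht.trans_le hl) t le_rfl)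
      by_cases hlr : (l : Multiset ι) ∈ Red
      · obtain ⟨f, hf, hfm⟩ := hred _ hlr
        -- Up to reordering the word is `f` followed by `u`. Rewriting `f` lowers the key of the
        -- whole word by `hadd`.
        obtain ⟨u, hu⟩ := Multiset.le_iff_exists_add.1 hf
        have hperm : l.Perm (f.toList ++ u.toList) := by
          rw [← Multiset.coe_eq_coe, hu, ← Multiset.coe_add, Multiset.coe_toList,
            Multiset.coe_toList]
        have hw : (l.map ω).sum = (f.toList.map ω).sum + (u.toList.map ω).sum := by
          rw [(hperm.map ω).sum_eq, List.map_append, List.sum_append]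
        have h1 := hlow (word_sub_word_mem_of_perm a ω hcomm hperm)
        have h2 : (f.toList.map a).prod * (u.toList.map a).prod ∈ H := by
          have := word_mul_mem_wordSpan a (q := fun t => (t.map ω).sum < (l.map ω).sum ∨
            ((t.map ω).sum ≤ (l.map ω).sum ∧ key t < key l)) hfm [] u.toList (fun t ht => by
              simp only [List.nil_append, List.map_append, List.sum_append]
              rcases ht with ht | ⟨ht, hk⟩
              · left; omega
              · refine Or.inr ⟨by omega, ?_⟩
                rw [hu, ← Multiset.coe_add, Multiset.coe_toList]
                exact hadd _ _ _ hk)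
          simp only [List.map_nil, List.prod_nil, one_mul] at this
          refine wordSpan_le a (fun t ht => ?_) this
          rcases ht with ht | ⟨ht, hk⟩
          · exact hlow (word_mem_wordSpan a ht)
          · exact ihκ _ hk t rfl (ht.trans hl)
        rw [List.map_append, List.prod_append] at h1
        simpa using add_mem h1 h2
      · have hperm : l.Perm (l : Multiset ι).toList := by
          rw [← Multiset.coe_eq_coe, Multiset.coe_toList]
        have h1 := hlow (word_sub_word_mem_of_perm a ω hcomm hperm)
        have h2 : ((l : Multiset ι).toList.map a).prod ∈ H :=
          word_mem_wordSpan a ⟨⟨_, hlr, rfl⟩, by rw [← (hperm.map ω).sum_eq]; exact hl⟩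
        simpa using add_mem h1 h2

/-- Vectors indexed by a linear order none of which lies in the span of the previous ones are
linearly independent. -/
theorem linearIndependent_of_notMem_span_lt {V κ : Type*} [AddCommGroup V] [Module k V] (v : κ → V)
    (key : κ → O) (hkey : Function.Injective key)
    (h : ∀ i, v i ∉ Submodule.span k (v '' {j | key j < key i})) : LinearIndependent k v := by
  classical
  rw [linearIndependent_iff']
  intro s g hg
  by_contra! H
  obtain ⟨i₀, hi₀, hgi₀⟩ := H
  obtain ⟨i, hi, hmax⟩ := (s.filter fun i => g i ≠ 0).exists_max_image key
    ⟨i₀, Finset.mem_filter.2 ⟨hi₀, hgi₀⟩⟩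
  obtain ⟨his, hgi⟩ := Finset.mem_filter.1 hi
  refine h i ?_
  have h1 : g i • v i = -∑ j ∈ s.erase i, g j • v j := by
    rw [eq_neg_iff_add_eq_zero, Finset.add_sum_erase s (fun j => g j • v j) his, hg]
  have h2 : v i = (g i)⁻¹ • -∑ j ∈ s.erase i, g j • v j := by
    rw [← h1, inv_smul_smul₀ hgi]
  rw [h2]
  refine Submodule.smul_mem _ _ (neg_mem (Submodule.sum_mem _ fun j hj => ?_))
  obtain ⟨hji, hjs⟩ := Finset.mem_erase.1 hj
  by_cases hgj : g j = 0
  · rw [hgj, zero_smul]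
    exact zero_mem _
  · refine Submodule.smul_mem _ _ (Submodule.subset_span ⟨j, ?_, rfl⟩)
    exact lt_of_le_of_ne (hmax j (Finset.mem_filter.2 ⟨hjs, hgj⟩)) fun h => hji (hkey h)

/-- In a well quasi-order, every set is bounded below by finitely many of its elements. -/
theorem exists_finset_forall_exists_le {α : Type*} [PartialOrder α] [WellQuasiOrderedLE α]
    (S : Set α) : ∃ F : Finset α, (F : Set α) ⊆ S ∧ ∀ s ∈ S, ∃ f ∈ F, f ≤ s := by
  have hanti : IsAntichain (· ≤ ·) {s | Minimal (· ∈ S) s} := fun s hs t ht hne hle =>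
    hne (le_antisymm hle (ht.2 hs.1 hle))
  have hfin := WellQuasiOrderedLE.finite_of_isAntichain hanti
  refine ⟨hfin.toFinset, fun s hs => ?_, fun s hs => ?_⟩
  · exact (hfin.mem_toFinset.1 hs).1
  · obtain ⟨f, hf, hfm⟩ := exists_minimal_le_of_wellFoundedLT (· ∈ S) s hs
    exact ⟨f, hfin.mem_toFinset.2 hfm, hf⟩

end Words

/-! ### Upper bound for the dimension by the growth of the graded ring -/

namespace SymbolMap

variable {k R : Type*} [Field k] [Ring R] [Algebra k R] {Γ : AlgFiltration k R}
  {A : Type*} [CommRing A] [Algebra k A] (σ : SymbolMap Γ A)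
  {ι : Type*} (δ : ι → ℕ) (a : ∀ i, Γ.piece (δ i))

theorem word_mem_piece (l : List ι) : (l.map fun i => (a i : R)).prod ∈ Γ.piece (l.map δ).sum := by
  induction l with
  | nil => exact Γ.one_mem
  | cons i l ih => exact Γ.mul_mem (a i).2 ih

theorem symb_word (l : List ι) :
    σ.symb _ ⟨_, word_mem_piece δ a l⟩ = (l.map fun i => σ.symb (δ i) (a i)).prod := by
  induction l with
  | nil => exact σ.symb_one
  | cons i l ih =>
    exact (σ.symb_mul (a i) ⟨_, word_mem_piece δ a l⟩).trans (congrArg (_ * ·) ih)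

/-- A combination of words of degree `D` in the symbols of the `a i` is the symbol of the same
combination of words in the `a i`. -/
theorem exists_symb_eq_of_mem_wordSpan {p : List ι → Prop} {D : ℕ} {y : A}
    (hy : y ∈ wordSpan k (fun i => σ.symb (δ i) (a i)) fun l => p l ∧ (l.map δ).sum = D) :
    ∃ r : Γ.piece D, (r : R) ∈ wordSpan k (fun i => (a i : R))
      (fun l => p l ∧ (l.map δ).sum = D) ∧ σ.symb D r = y := by
  induction hy using Submodule.span_induction with
  | mem y hy =>
    obtain ⟨l, ⟨hl, rfl⟩, rfl⟩ := hy
    exact ⟨⟨_, word_mem_piece δ a l⟩, word_mem_wordSpan _ ⟨hl, rfl⟩, σ.symb_word δ a l⟩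
  | zero => exact ⟨0, zero_mem _, map_zero _⟩
  | add x y _ _ hx hy =>
    obtain ⟨r, hr, hrx⟩ := hx
    obtain ⟨s, hs, hsy⟩ := hy
    exact ⟨r + s, add_mem hr hs, by rw [map_add, hrx, hsy]⟩
  | smul c x _ hx =>
    obtain ⟨r, hr, hrx⟩ := hx
    exact ⟨c • r, Submodule.smul_mem _ c hr, by rw [map_smul, hrx]⟩

/-- Words in homogeneous letters are homogeneous, so a component of a combination just selects the
words of that degree. -/
theorem comp_mem_wordSpan {p : List ι → Prop} (D : ℕ) {y : A}
    (hy : y ∈ wordSpan k (fun i => σ.symb (δ i) (a i)) p) :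
    σ.comp D y ∈ wordSpan k (fun i => σ.symb (δ i) (a i)) fun l => p l ∧ (l.map δ).sum = D := by
  refine (wordSpan_le (U := (wordSpan k (fun i => σ.symb (δ i) (a i))
    fun l => p l ∧ (l.map δ).sum = D).comap (σ.comp D)) _ fun l hl => ?_) hy
  rw [Submodule.mem_comap, ← σ.symb_word]
  by_cases h : (l.map δ).sum = D
  · subst h
    rw [σ.comp_symb_same, σ.symb_word]
    exact word_mem_wordSpan _ ⟨hl, rfl⟩
  · rw [σ.comp_symb_of_ne h]
    exact zero_mem _

variable (hgen : Algebra.adjoin k (Set.range fun i => σ.symb (δ i) (a i)) = ⊤)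

include hgen in
theorem mem_wordSpan_of_adjoin (y : A) :
    y ∈ wordSpan k (fun i => σ.symb (δ i) (a i)) fun _ => True := by
  have hy : y ∈ Algebra.adjoin k (Set.range fun i => σ.symb (δ i) (a i)) := hgen ▸ trivial
  rw [← Subalgebra.mem_toSubmodule, Algebra.adjoin_eq_span] at hy
  refine Submodule.span_mono ?_ hy
  intro z hz
  induction hz using Submonoid.closure_induction with
  | mem z hz =>
    obtain ⟨i, rfl⟩ := hz
    exact ⟨[i], trivial, by simp⟩
  | one => exact ⟨[], trivial, rfl⟩
  | mul x y _ _ hx hy =>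
    obtain ⟨l, -, rfl⟩ := hx
    obtain ⟨l', -, rfl⟩ := hy
    exact ⟨l ++ l', trivial, by simp⟩

include hgen in
/-- Lifts of homogeneous generators of the associated graded algebra generate `R` compatibly with
the filtration. -/
theorem mem_wordSpan_of_mem_piece (D : ℕ) (r : R) (hr : r ∈ Γ.piece D) :
    r ∈ wordSpan k (fun i => (a i : R)) fun l => (l.map δ).sum ≤ D := by
  have step (D : ℕ) (r : R) (hr : r ∈ Γ.piece D) : ∃ s ∈ wordSpan k (fun i => (a i : R))
      (fun l => (l.map δ).sum ≤ D), r - s ∈ Γ.below D := by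
    have h1 := σ.comp_mem_wordSpan δ a D (σ.mem_wordSpan_of_adjoin δ a hgen (σ.symb D ⟨r, hr⟩))
    rw [σ.comp_symb_same] at h1
    obtain ⟨s, hs, hsr⟩ := σ.exists_symb_eq_of_mem_wordSpan δ a h1
    refine ⟨s, wordSpan_mono _ (fun l hl => hl.2.le) hs, ?_⟩
    have : σ.symb D (⟨r, hr⟩ - s) = 0 := by rw [map_sub, hsr, sub_self]
    exact (σ.symb_eq_zero_iff _).1 this
  induction D generalizing r with
  | zero =>
    obtain ⟨s, hs, hrs⟩ := step 0 r hr
    rwa [sub_eq_zero.1 hrs]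
  | succ D ih =>
    obtain ⟨s, hs, hrs⟩ := step (D + 1) r hr
    have := add_mem (wordSpan_mono _ (fun l hl => Nat.le_succ_of_le hl) (ih _ hrs)) hs
    rwa [sub_add_cancel] at this

include hgen in
/-- An element of lower filtration degree is a combination of words of smaller weight, for the
weights `N δ + length` with `N` large. -/
theorem exists_mem_wordSpan_of_mem_below (D : ℕ) (r : R) (hr : r ∈ Γ.below D) :
    ∃ N₀ : ℕ, ∀ N ≥ N₀, r ∈ wordSpan k (fun i => (a i : R))
      fun l => (l.map fun i => N * δ i + 1).sum < N * D := by
  obtain _ | D := D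
  · refine ⟨0, fun N _ => ?_⟩
    rw [show r = 0 from hr]
    exact zero_mem _
  · have h1 := σ.mem_wordSpan_of_mem_piece δ a hgen D r hr
    have hw (N : ℕ) (l : List ι) :
        (l.map fun i => N * δ i + 1).sum = N * (l.map δ).sum + l.length := by
      induction l with
      | nil => simp
      | cons i l ih => simp only [List.map_cons, List.sum_cons, ih, List.length_cons]; ring
    clear hr
    induction h1 using Submodule.span_induction with
    | mem y hy =>
      obtain ⟨l, hl, rfl⟩ := hy
      -- The weight is `N` times the degree plus the length, so once `N` exceeds the length a drop
      -- in degree outweighs it.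
      refine ⟨l.length + 1, fun N hN => word_mem_wordSpan _ ?_⟩
      rw [hw]
      have := Nat.mul_le_mul_left N hl
      rw [mul_add]
      omega
    | zero => exact ⟨0, fun N _ => zero_mem _⟩
    | add x y _ _ hx hy =>
      obtain ⟨N₁, h₁⟩ := hx
      obtain ⟨N₂, h₂⟩ := hy
      exact ⟨max N₁ N₂, fun N hN => add_mem (h₁ N (le_of_max_le_left hN))
        (h₂ N (le_of_max_le_right hN))⟩
    | smul c x _ hx =>
      obtain ⟨N₁, h₁⟩ := hx
      exact ⟨N₁, fun N hN => Submodule.smul_mem _ c (h₁ N hN)⟩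

theorem exists_generators [Algebra.FiniteType k A] :
    ∃ (m : ℕ) (δ : Fin m → ℕ) (a : ∀ i, Γ.piece (δ i)),
      Algebra.adjoin k (Set.range fun i => σ.symb (δ i) (a i)) = ⊤ := by
  classical
  obtain ⟨t, ht⟩ := Algebra.FiniteType.out (R := k) (A := A)
  have hex (y : A) : ∃ T : Finset A, (T : Set A) ⊆ {x | ∃ n a, σ.symb n a = x} ∧
      y ∈ Submodule.span k (T : Set A) :=
    Submodule.mem_span_finite_of_mem_span (σ.span_eq_top ▸ trivial)
  choose T hT hyT using hex
  let F := t.biUnion T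
  have hF (x : A) (hx : x ∈ F) : ∃ n a, σ.symb n a = x := by
    obtain ⟨y, -, hxy⟩ := Finset.mem_biUnion.1 hx
    exact hT y hxy
  choose n a ha using fun i : Fin F.card => hF (F.equivFin.symm i) (F.equivFin.symm i).2
  refine ⟨F.card, n, a, eq_top_iff.2 ?_⟩
  rw [← ht]
  refine Algebra.adjoin_le fun y hy => ?_
  refine (Submodule.span_le.2 ?_ : Submodule.span k (T y : Set A) ≤
    Subalgebra.toSubmodule (Algebra.adjoin k (Set.range fun i => σ.symb (n i) (a i)))) (hyT y)
  intro x hx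
  refine Algebra.subset_adjoin ⟨F.equivFin ⟨x, Finset.mem_biUnion.2 ⟨y, hy, hx⟩⟩, ?_⟩
  exact (ha _).trans (by rw [Equiv.symm_apply_apply])

/-- The multisets `s` such that the product of the letters `x i`, `i ∈ s`, is a linear combination
of products over smaller multisets. -/
def reducible (k : Type*) {A ι O : Type*} [Field k] [CommRing A] [Algebra k A] [LinearOrder O]
    (x : ι → A) (key : Multiset ι → O) : Set (Multiset ι) :=
  {s | (s.map x).prod ∈
    Submodule.span k ((fun t : Multiset ι => (t.map x).prod) '' {t | key t < key s})}

/-- There are at most as many irreducible multisets with at most `n` elements as the dimension of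
the space of polynomials of degree at most `n` in the `x i`. -/
theorem finite_and_ncard_le {ι O : Type*} [Finite ι] [LinearOrder O] (x : ι → A)
    (key : Multiset ι → O) (hkey : Function.Injective key) (n : ℕ) :
    {s | s ∉ reducible k x key ∧ s.card ≤ n}.Finite ∧
      {s | s ∉ reducible k x key ∧ s.card ≤ n}.ncard ≤
        Module.finrank k ((1 ⊔ Submodule.span k (Set.range x)) ^ n : Submodule k A) := by
  set W : Submodule k A := 1 ⊔ Submodule.span k (Set.range x) with hW
  have hWfg : W.FG := Submodule.FG.sup ⟨{1}, by rw [Submodule.one_eq_span]; simp⟩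
    (Submodule.fg_span (Set.finite_range x))
  have hfin : Module.Finite k (W ^ n : Submodule k A) := Module.Finite.of_fg (hWfg.pow n)
  have h1W : 1 ≤ W := le_sup_left
  have hmem (s : Multiset ι) : (s.map x).prod ∈ W ^ s.card := by
    induction s using Multiset.induction_on with
    | empty => exact Submodule.one_le.1 le_rfl
    | cons i s ih =>
      rw [Multiset.map_cons, Multiset.prod_cons, Multiset.card_cons, pow_succ']
      exact Submodule.mul_mem_mul ((le_sup_right : Submodule.span k (Set.range x) ≤ W) (Submodule.subset_span ⟨i, rfl⟩)) ih
  let S := {s | s ∉ reducible k x key ∧ s.card ≤ n}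
  let v (s : S) : (W ^ n : Submodule k A) :=
    ⟨(s.1.map x).prod, pow_le_pow_right₀ h1W s.2.2 (hmem s.1)⟩
  -- Irreducibility says precisely that no monomial lies in the span of those with smaller key.
  have hli : LinearIndependent k fun s : S => (s.1.map x).prod := by
    refine linearIndependent_of_notMem_span_lt _ (fun s : S => key s.1)
      (fun s t h => Subtype.ext (hkey h)) fun s hs => s.2.1 (Submodule.span_mono ?_ hs)
    rintro _ ⟨t, ht, rfl⟩
    exact ⟨t.1, ht, rfl⟩
  have hv : LinearIndependent k v := LinearIndependent.of_comp (W ^ n : Submodule k A).subtype hli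
  have hS : Finite S := hv.finite_of_isNoetherian
  refine ⟨hS, ?_⟩
  have : Fintype S := Fintype.ofFinite S
  have := hv.fintype_card_le_finrank
  rwa [← Nat.card_eq_fintype_card] at this

/-- For a suitable weight, commutators of letters have lower weight and the minimal reducible
monomials can be rewritten. -/
theorem exists_weight [Finite ι] {O : Type*} [LinearOrder O] (key : Multiset ι → O)
    (hcard : ∀ s t, key s < key t → s.card ≤ t.card)
    (hgen : Algebra.adjoin k (Set.range fun i => σ.symb (δ i) (a i)) = ⊤) :
    ∃ N : ℕ, (∀ i j, (a i * a j - a j * a i : R) ∈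
        wordSpan k (fun i => (a i : R)) fun l =>
          (l.map fun i => N * δ i + 1).sum < (N * δ i + 1) + (N * δ j + 1)) ∧
      ∀ s ∈ reducible k (fun i => σ.symb (δ i) (a i)) key, ∃ f ≤ s,
        (f.toList.map fun i => (a i : R)).prod ∈ wordSpan k (fun i => (a i : R)) fun l =>
          (l.map fun i => N * δ i + 1).sum < (f.toList.map fun i => N * δ i + 1).sum ∨
          ((l.map fun i => N * δ i + 1).sum ≤ (f.toList.map fun i => N * δ i + 1).sum ∧
            key l < key f) := by
  classical
  set x : ι → A := fun i => σ.symb (δ i) (a i) with hx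
  -- Dickson's lemma leaves finitely many minimal reducible multisets. With the finitely many
  -- commutators, they impose finitely many conditions on `N`, so one value suits all.
  have : WellQuasiOrderedLE (Multiset ι) :=
    Finsupp.orderIsoMultiset.monotone.wellQuasiOrderedLE_of_wellQuasiOrderedLE_of_surjective
      Finsupp.orderIsoMultiset.surjective
  obtain ⟨F, hFR, hF⟩ := exists_finset_forall_exists_le (reducible k x key)
  have hcomm (i j : ι) : (a i * a j - a j * a i : R) ∈ Γ.below (δ i + δ j) := by
    have h1 : (a j * a i : R) ∈ Γ.piece (δ i + δ j) := by
      rw [add_comm]; exact Γ.mul_mem (a j).2 (a i).2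
    refine (σ.symb_eq_zero_iff (⟨a i * a j, Γ.mul_mem (a i).2 (a j).2⟩ - ⟨a j * a i, h1⟩)).1 ?_
    rw [map_sub, σ.symb_mul, σ.symb_mul_mem (add_comm (δ j) (δ i)) (a j) (a i) ⟨_, h1⟩ rfl,
      mul_comm, sub_self]
  -- The relation that makes `f` reducible is cut down to the degree of `f` and lifted to `R`, with
  -- an error of lower filtration degree.
  have hred (f : F) : ∃ r ∈ wordSpan k (fun i => (a i : R))
      (fun l => key l < key f.1 ∧ (l.map δ).sum = (f.1.toList.map δ).sum),
      (f.1.toList.map fun i => (a i : R)).prod - r ∈ Γ.below (f.1.toList.map δ).sum := by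
    have h1 : (f.1.toList.map x).prod ∈ wordSpan k x fun l => key l < key f.1 := by
      have h2 : (f.1.map x).prod ∈ Submodule.span k
          ((fun t : Multiset ι => (t.map x).prod) '' {t | key t < key f.1}) := hFR f.2
      have h3 : (f.1.toList.map x).prod = (f.1.map x).prod := by
        conv_rhs => rw [← Multiset.coe_toList f.1, Multiset.map_coe, Multiset.prod_coe]
      rw [h3]
      refine Submodule.span_mono ?_ h2
      rintro _ ⟨t, ht, rfl⟩
      refine ⟨t.toList, ?_, ?_⟩
      · simpa using ht
      · change (t.toList.map x).prod = (t.map x).prod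
        conv_rhs => rw [← Multiset.coe_toList t, Multiset.map_coe, Multiset.prod_coe]
    have h4 := σ.comp_mem_wordSpan δ a (f.1.toList.map δ).sum h1
    rw [← σ.symb_word δ a, σ.comp_symb_same] at h4
    obtain ⟨r, hr, hrf⟩ := σ.exists_symb_eq_of_mem_wordSpan δ a h4
    refine ⟨r, hr, ?_⟩
    have : σ.symb _ (⟨_, word_mem_piece δ a f.1.toList⟩ - r) = 0 := by rw [map_sub, hrf, sub_self]
    exact (σ.symb_eq_zero_iff _).1 this
  choose r hr hrf using hred
  choose N₁ hN₁ using fun p : ι × ι =>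
    σ.exists_mem_wordSpan_of_mem_below δ a hgen _ _ (hcomm p.1 p.2)
  choose N₂ hN₂ using fun f => σ.exists_mem_wordSpan_of_mem_below δ a hgen _ _ (hrf f)
  have : Fintype ι := Fintype.ofFinite ι
  let N := Finset.univ.sup N₁ + Finset.univ.sup N₂
  have hle₁ (p : ι × ι) : N₁ p ≤ N := (Finset.le_sup (Finset.mem_univ p)).trans le_self_add
  have hle₂ (f : F) : N₂ f ≤ N := (Finset.le_sup (Finset.mem_univ f)).trans le_add_self
  have hw (l : List ι) : (l.map fun i => N * δ i + 1).sum = N * (l.map δ).sum + l.length := by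
    induction l with
    | nil => simp
    | cons i l ih => simp only [List.map_cons, List.sum_cons, ih, List.length_cons]; ring
  refine ⟨N, fun i j => ?_, fun s hs => ?_⟩
  · refine wordSpan_mono _ (fun l hl => ?_) (hN₁ (i, j) N (hle₁ _))
    simp only [mul_add] at hl
    omega
  · obtain ⟨f, hfF, hfs⟩ := hF s hs
    refine ⟨f, hfs, ?_⟩
    have h1 := wordSpan_mono (k := k) (fun i => (a i : R)) (q := fun l =>
          (l.map fun i => N * δ i + 1).sum < (f.toList.map fun i => N * δ i + 1).sum ∨
          ((l.map fun i => N * δ i + 1).sum ≤ (f.toList.map fun i => N * δ i + 1).sum ∧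
            key l < key f)) (fun l hl => Or.inl (lt_of_lt_of_le hl (by rw [hw]; exact Nat.le_add_right _ _)))
        (hN₂ ⟨f, hfF⟩ N (hle₂ _))
    -- These words have the same filtration degree as `f`, so their weights compare as their lengths
    -- do, and `hcard` compares the lengths.
    have h2 := wordSpan_mono (k := k) (fun i => (a i : R)) (q := fun l =>
          (l.map fun i => N * δ i + 1).sum < (f.toList.map fun i => N * δ i + 1).sum ∨
          ((l.map fun i => N * δ i + 1).sum ≤ (f.toList.map fun i => N * δ i + 1).sum ∧
            key l < key f)) (fun l hl => Or.inr ⟨by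
              have := hcard _ _ hl.1
              rw [hw, hw, hl.2, Multiset.length_toList]
              simpa using this, hl.1⟩) (hr ⟨f, hfF⟩)
    simpa using add_mem h1 h2

theorem exists_le_wordSpan
    (hgen : Algebra.adjoin k (Set.range fun i => σ.symb (δ i) (a i)) = ⊤) (ω : ι → ℕ)
    (V : Submodule k R) (hV : V.FG) :
    ∃ c, V ≤ wordSpan k (fun i => (a i : R)) fun l => (l.map ω).sum ≤ c := by
  have hex (r : R) : ∃ c, r ∈ wordSpan k (fun i => (a i : R)) fun l => (l.map ω).sum ≤ c := by
    obtain ⟨D, hD⟩ := Γ.exhaustive r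
    have h1 := σ.mem_wordSpan_of_mem_piece δ a hgen D r hD
    clear hD
    induction h1 using Submodule.span_induction with
    | mem y hy =>
      obtain ⟨l, -, rfl⟩ := hy
      exact ⟨_, word_mem_wordSpan _ le_rfl⟩
    | zero => exact ⟨0, zero_mem _⟩
    | add x y _ _ hx hy =>
      obtain ⟨c, hc⟩ := hx
      obtain ⟨c', hc'⟩ := hy
      exact ⟨max c c', add_mem (wordSpan_mono _ (fun l hl => le_max_of_le_left hl) hc)
        (wordSpan_mono _ (fun l hl => le_max_of_le_right hl) hc')⟩
    | smul b x _ hx =>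
      obtain ⟨c, hc⟩ := hx
      exact ⟨c, Submodule.smul_mem _ b hc⟩
  obtain ⟨t, rfl⟩ := hV
  choose c hc using hex
  exact ⟨t.sup c, Submodule.span_le.2 fun x hx =>
    wordSpan_mono _ (fun l hl => hl.trans (Finset.le_sup (f := c) hx)) (hc x)⟩

theorem wordSpan_pow_le (b : ι → R) (ω : ι → ℕ) (c n : ℕ) :
    wordSpan k b (fun l => (l.map ω).sum ≤ c) ^ n ≤
      wordSpan k b fun l => (l.map ω).sum ≤ c * n := by
  induction n with
  | zero =>
    rw [pow_zero, Submodule.one_le]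
    exact word_mem_wordSpan b (l := []) (by simp)
  | succ n ih =>
    rw [pow_succ]
    refine (mul_le_mul_left ih _).trans ?_
    rw [wordSpan, wordSpan, Submodule.span_mul_span, Submodule.span_le]
    rintro _ ⟨_, ⟨l, hl, rfl⟩, _, ⟨l', hl', rfl⟩, rfl⟩
    refine Submodule.subset_span ⟨l ++ l', ?_, by simp⟩
    have h1 : (l.map ω).sum ≤ c * n := hl
    have h2 : (l'.map ω).sum ≤ c := hl'
    change ((l ++ l').map ω).sum ≤ c * (n + 1)
    rw [List.map_append, List.sum_append, mul_add]
    omega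

/-- The Gelfand-Kirillov dimension of a filtered algebra whose associated graded algebra is
commutative and finitely generated is at most the degree of growth of the latter. -/
theorem gkDim_le_of_growth (σ : SymbolMap Γ A) [Algebra.FiniteType k A] (d : ℕ)
    (hgrow : ∀ W : Submodule k A, W.FG →
      ∃ C : ℕ, ∀ n : ℕ, Module.finrank k (W ^ n : Submodule k A) ≤ C * (n + 1) ^ d) :
    gkDim k R ≤ d := by
  obtain ⟨m, δ, a, hgen⟩ := σ.exists_generators
  -- The order must be well founded, additive, and must compare the number of letters first.
  let mo := MonomialOrder.degLex (σ := Fin m)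
  let key (s : Multiset (Fin m)) : mo.syn := mo.toSyn (Multiset.toFinsupp s)
  have hkey : Function.Injective key :=
    mo.toSyn.injective.comp Multiset.toFinsupp.injective
  have hadd (s t u) (h : key s < key t) : key (s + u) < key (t + u) := by
    simp only [key, map_add] at h ⊢
    exact add_lt_add_left h _
  have hcard (s t) (h : key s < key t) : s.card ≤ t.card := by
    have h1 := MonomialOrder.degLex_le_iff.1 h.le
    have h2 := Finsupp.DegLex.monotone_degree h1
    have hdeg (s : Multiset (Fin m)) : (Multiset.toFinsupp s).degree = s.card := by
      induction s using Multiset.induction_on with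
      | empty => simp
      | cons i s ih =>
        rw [← Multiset.singleton_add, map_add, map_add, ih, Multiset.toFinsupp_singleton,
          Finsupp.degree_single, Multiset.card_add, Multiset.card_singleton]
    simpa [hdeg] using h2
  obtain ⟨N, hcomm, hred⟩ := σ.exists_weight δ a key hcard hgen
  set ω : Fin m → ℕ := fun i => N * δ i + 1 with hω
  let x : Fin m → A := fun i => σ.symb (δ i) (a i)
  let b : Fin m → R := fun i => (a i : R)
  have hirr := word_mem_wordSpan_irreducible (k := k) b ω hcomm key hadd (reducible k x key) hred
  obtain ⟨C, hC⟩ := hgrow (1 ⊔ Submodule.span k (Set.range x))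
    (Submodule.FG.sup ⟨{1}, by rw [Submodule.one_eq_span]; simp⟩
      (Submodule.fg_span (Set.finite_range x)))
  -- This is the point of the `+ 1` in the weight: letters of filtration degree zero still weigh
  -- something, so bounded weight means bounded length.
  have hlen (l : List (Fin m)) : l.length ≤ (l.map ω).sum := by
    induction l with
    | nil => simp
    | cons i l ih => simp only [List.map_cons, List.sum_cons, List.length_cons, hω] at ih ⊢; omega
  -- words of weight at most `n` span a space of polynomially bounded dimension
  have hbound (n : ℕ) (U : Submodule k R) (hU : U ≤ wordSpan k b fun l => (l.map ω).sum ≤ n) :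
      Module.finrank k U ≤ C * (n + 1) ^ d := by
    obtain ⟨hfin, hncard⟩ := finite_and_ncard_le (k := k) x key hkey n
    refine le_trans ?_ (hncard.trans (hC n))
    let S := {s | s ∉ reducible k x key ∧ s.card ≤ n}
    have hUS : U ≤ Submodule.span k ((fun s : Multiset (Fin m) => (s.toList.map b).prod) '' S) := by
      refine hU.trans (wordSpan_le b fun l hl => Submodule.span_mono ?_ (hirr l))
      rintro _ ⟨_, ⟨⟨s, hs, rfl⟩, ht⟩, rfl⟩
      refine ⟨s, ⟨hs, ?_⟩, rfl⟩
      rw [← Multiset.length_toList]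
      exact (hlen _).trans (ht.trans hl)
    have hfin' : ((fun s : Multiset (Fin m) => (s.toList.map b).prod) '' S).Finite := hfin.image _
    have : Module.Finite k
        (Submodule.span k ((fun s : Multiset (Fin m) => (s.toList.map b).prod) '' S)) :=
      Module.Finite.span_of_finite k hfin'
    refine (Submodule.finrank_mono hUS).trans ?_
    have := hfin'.fintype
    refine (finrank_span_le_card _).trans ?_
    rw [← Set.ncard_eq_toFinset_card']
    exact Set.ncard_image_le hfin
  refine gkDim_le d fun V hV => ?_
  obtain ⟨c, hc⟩ := σ.exists_le_wordSpan δ a hgen ω (1 ⊔ V)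
    (Submodule.FG.sup ⟨{1}, by rw [Submodule.one_eq_span]; simp⟩ hV)
  refine ⟨C * (c + 1) ^ d, fun n => ?_⟩
  refine (hbound (c * n) _ ((pow_le_pow_left' hc n).trans (wordSpan_pow_le b ω c n))).trans ?_
  rw [mul_assoc, ← mul_pow]
  gcongr
  nlinarith

end SymbolMap

/-! ### Cancellation of ideals with small quotient -/

/-- Let `R` be a filtered algebra whose associated graded algebra is an affine Gorenstein domain and
`I` an ideal with `GKdim (R / I) ≤ GKdim R - 2`. Then `I a ⊆ R b` implies `a ∈ R b`, and `a I ⊆ b R`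
implies `a ∈ b R`. -/
theorem SymbolMap.exists_eq_mul_of_gkDim_quotient_le {k R A : Type*} [Field k] [Ring R]
    [Algebra k R] {Γ : AlgFiltration k R} [CommRing A] [Algebra k A] (σ : SymbolMap Γ A)
    [IsDomain A] [IsNoetherianRing A] [Algebra.FiniteType k A]
    (hG : ∀ (p : Ideal A) [p.IsPrime], ∃ n, CategoryTheory.HasInjectiveDimensionLE
      (ModuleCat.of (Localization.AtPrime p) (Localization.AtPrime p)) n)
    (I : Ideal R) [I.IsTwoSided] (hI : gkDim k (R ⧸ I) ≤ gkDim k R - 2)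
    {b : R} (hb : b ≠ 0) (a : R) :
    ((∀ r ∈ I, ∃ s, r * a = s * b) → ∃ s, a = s * b) ∧
      ((∀ r ∈ I, ∃ s, a * r = b * s) → ∃ s, a = b * s) := by
  refine σ.exists_eq_mul_of_forall_mem (I.restrictScalars k) (fun x y hy h => ?_) hb a
  refine dvd_of_forall_mem_dvd_mul hG _ (fun P hP hh hJ => ?_) x y hy h
  -- By Noether normalization the same `d` bounds `GKdim R` from above and, less one, `GKdim (R /
  -- I)` from below.
  obtain ⟨d, g, hg, hfin⟩ := exists_finite_inj_algHom_of_fg k A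
  obtain ⟨z, hz⟩ := exists_aeval_mem_imp_eq_zero g hg hfin P hh
  have h1 := σ.le_gkDim_quotient I P (Ideal.subset_span.trans hJ) (d - 1) z hz
  have h2 := σ.gkDim_le_of_growth d (fun W hW => exists_finrank_pow_le k g hfin W hW)
  have h3 : ((d - 1 : ℕ) : EReal) ≤ (d : EReal) - 2 :=
    (h1.trans hI).trans (EReal.sub_le_sub h2 le_rfl)
  have h4 : (((d - 1 : ℕ) : ℝ) : EReal) ≤ (((d : ℝ) - 2 : ℝ) : EReal) := by
    rw [EReal.coe_sub]
    exact h3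
  have h5 : ((d - 1 : ℕ) : ℝ) ≤ (d : ℝ) - 2 := EReal.coe_le_coe_iff.1 h4
  -- Truncation at `d = 0` only makes `d - 1` larger, so the contradiction persists.
  have h6 : (d : ℝ) ≤ ((d - 1 : ℕ) : ℝ) + 1 := by exact_mod_cast (by omega : d ≤ d - 1 + 1)
  linarith

/-! ### The associated graded algebra as a symbol map, and its subalgebras -/

namespace AlgFiltration

variable {k R : Type*} [Field k] [Ring R] [Algebra k R] (Γ : AlgFiltration k R)

/-- The symbol in degree `n`, as an element of the associated graded algebra. -/
def grSymb (n : ℕ) : Γ.piece n →ₗ[k] Γ.Gr := DirectSum.lof k ℕ Γ.GrPiece n ∘ₗ Γ.symb n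

/-- The projection of the associated graded algebra to its component of degree `n`. -/
def grComp (n : ℕ) : Γ.Gr →ₗ[k] Γ.Gr :=
  DirectSum.lof k ℕ Γ.GrPiece n ∘ₗ DirectSum.component k ℕ Γ.GrPiece n

theorem grSymb_mul {i j : ℕ} (a : Γ.piece i) (b : Γ.piece j) :
    Γ.grSymb (i + j) ⟨a * b, Γ.mul_mem a.2 b.2⟩ = Γ.grSymb i a * Γ.grSymb j b :=
  (DirectSum.of_mul_of (A := Γ.GrPiece) (Γ.symb i a) (Γ.symb j b)).symm

theorem grSymb_one : Γ.grSymb 0 ⟨1, Γ.one_mem⟩ = 1 := rfl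

theorem grSymb_eq_zero_iff {n : ℕ} (a : Γ.piece n) : Γ.grSymb n a = 0 ↔ (a : R) ∈ Γ.below n := by
  refine Iff.trans ?_ (Submodule.Quotient.mk_eq_zero ((Γ.below n).comap (Γ.piece n).subtype))
  exact (DirectSum.of_injective (β := Γ.GrPiece) n).eq_iff' (map_zero _)

theorem grComp_grSymb_same {n : ℕ} (a : Γ.piece n) : Γ.grComp n (Γ.grSymb n a) = Γ.grSymb n a :=
  congrArg (DirectSum.lof k ℕ Γ.GrPiece n) (DirectSum.component.lof_self k (M := Γ.GrPiece) n _)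

theorem grComp_grSymb_of_ne {m n : ℕ} (h : m ≠ n) (a : Γ.piece m) :
    Γ.grComp n (Γ.grSymb m a) = 0 := by
  have : DirectSum.component k ℕ Γ.GrPiece n (Γ.grSymb m a) = 0 :=
    DirectSum.of_eq_of_ne m n _ h.symm
  exact (congrArg (DirectSum.lof k ℕ Γ.GrPiece n) this).trans (map_zero _)

theorem span_grSymb : Submodule.span k {x | ∃ n a, Γ.grSymb n a = x} = ⊤ := by
  refine eq_top_iff.2 fun x _ => ?_
  induction x using DirectSum.induction_on with
  | zero => exact zero_mem _
  | of n x =>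
    obtain ⟨a, rfl⟩ := Γ.symb_surjective n x
    exact Submodule.subset_span ⟨n, a, rfl⟩
  | add x y hx hy => exact add_mem (hx trivial) (hy trivial)

/-- The commutative ring structure on a commutative associated graded algebra. -/
abbrev grCommRing (hcomm : ∀ a b : Γ.Gr, a * b = b * a) : CommRing Γ.Gr :=
  { (inferInstance : Ring Γ.Gr) with mul_comm := hcomm }

/-- The symbol maps to a commutative associated graded algebra. -/
def symbolMap (hcomm : ∀ a b : Γ.Gr, a * b = b * a) :
    letI := Γ.grCommRing hcomm
    SymbolMap Γ Γ.Gr :=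
  letI := Γ.grCommRing hcomm
  { symb := Γ.grSymb
    symb_mul := Γ.grSymb_mul
    symb_one := Γ.grSymb_one
    symb_eq_zero_iff := Γ.grSymb_eq_zero_iff
    comp := Γ.grComp
    comp_symb_same := Γ.grComp_grSymb_same
    comp_symb_of_ne := Γ.grComp_grSymb_of_ne
    span_eq_top := Γ.span_grSymb }

theorem exists_eq_mul_of_gkDim_quotient_le [IsDomain Γ.Gr] (hfin : Algebra.FiniteType k Γ.Gr)
    (hG : IsGorensteinRing Γ.Gr) (I : Ideal R) [I.IsTwoSided]
    (hI : gkDim k (R ⧸ I) ≤ gkDim k R - 2) {b : R} (hb : b ≠ 0) (a : R) :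
    ((∀ r ∈ I, ∃ s, r * a = s * b) → ∃ s, a = s * b) ∧
      ((∀ r ∈ I, ∃ s, a * r = b * s) → ∃ s, a = b * s) := by
  obtain ⟨hcomm, hN, hG⟩ := hG
  let _ := Γ.grCommRing hcomm
  have : IsNoetherianRing Γ.Gr := hN
  have : Algebra.FiniteType k Γ.Gr := hfin
  exact (Γ.symbolMap hcomm).exists_eq_mul_of_gkDim_quotient_le hG I hI hb a

section Subalgebra

variable (T : Subalgebra k R)

theorem grIncl_grSymb (n : ℕ) (a : (Γ.induced T).piece n) :
    Γ.grIncl T ((Γ.induced T).grSymb n a) = Γ.grSymb n (Γ.pieceIncl T n a) :=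
  DirectSum.lmap_lof (Γ.grPieceIncl T) n _

theorem grIncl_mul (x y : (Γ.induced T).Gr) :
    Γ.grIncl T (x * y) = Γ.grIncl T x * Γ.grIncl T y := by
  have hx : x ∈ Submodule.span k {x | ∃ n a, (Γ.induced T).grSymb n a = x} :=
    (Γ.induced T).span_grSymb ▸ trivial
  have hy : y ∈ Submodule.span k {x | ∃ n a, (Γ.induced T).grSymb n a = x} :=
    (Γ.induced T).span_grSymb ▸ trivial
  induction hx using Submodule.span_induction with
  | zero => simp
  | add x x' _ _ h h' => rw [add_mul, map_add, h, h', map_add, add_mul]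
  | smul c x _ h => rw [smul_mul_assoc, map_smul, h, map_smul, smul_mul_assoc]
  | mem x hx =>
    obtain ⟨m, a, rfl⟩ := hx
    induction hy using Submodule.span_induction with
    | zero => simp
    | add x x' _ _ h h' => rw [mul_add, map_add, h, h', map_add, mul_add]
    | smul c x _ h => rw [mul_smul_comm, map_smul, h, map_smul, mul_smul_comm]
    | mem y hy =>
      obtain ⟨n, b, rfl⟩ := hy
      rw [← grSymb_mul, grIncl_grSymb, grIncl_grSymb, grIncl_grSymb, ← grSymb_mul]
      rfl

theorem grIncl_injective : Function.Injective (Γ.grIncl T) := by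
  refine (DirectSum.lmap_injective (Γ.grPieceIncl T)).2 fun n => ?_
  rw [injective_iff_map_eq_zero]
  intro x hx
  obtain ⟨a, rfl⟩ := (Γ.induced T).symb_surjective n x
  have h : (Γ.pieceIncl T n a : R) ∈ Γ.below n :=
    (Submodule.Quotient.mk_eq_zero ((Γ.below n).comap (Γ.piece n).subtype)).1 hx
  refine (Γ.induced T).symb_eq_zero ?_
  cases n with
  | zero => exact Subtype.ext h
  | succ n => exact h

/-- The inclusion of associated graded algebras as a homomorphism of algebras. -/
def grInclHom : (Γ.induced T).Gr →ₐ[k] Γ.Gr :=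
  AlgHom.ofLinearMap (Γ.grIncl T) (Γ.grIncl_grSymb T 0 ⟨1, (Γ.induced T).one_mem⟩)
    (Γ.grIncl_mul T)

theorem isDomain_gr_induced [IsDomain Γ.Gr] : IsDomain (Γ.induced T).Gr :=
  Function.Injective.isDomain (Γ.grInclHom T).toRingHom (Γ.grIncl_injective T)

variable {Γ T} in
-- Algebra generators of `C` together with module generators over `C` generate the image of `gr T`,
-- and finite generation pulls back along the injection.
theorem GrFiniteOver.finiteType {C : Subalgebra k Γ.Gr} (h : Γ.GrFiniteOver T C) (hC : C.FG) :
    Algebra.FiniteType k (Γ.induced T).Gr := by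
  classical
  obtain ⟨hCT, t, ht⟩ := h
  obtain ⟨s, hs⟩ := hC
  have hr : (((Γ.grInclHom T).range : Subalgebra k Γ.Gr) : Set Γ.Gr) = Set.range (Γ.grIncl T) := rfl
  refine ⟨Subalgebra.fg_of_fg_map _ (Γ.grInclHom T) (Γ.grIncl_injective T) ⟨s ∪ t, ?_⟩⟩
  rw [Algebra.map_top]
  refine le_antisymm (Algebra.adjoin_le fun x hx => ?_) fun x hx => ?_
  · rw [hr]
    rcases Finset.mem_union.1 (Finset.mem_coe.1 hx) with hx | hx
    · exact hCT (hs ▸ Algebra.subset_adjoin hx)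
    · rw [← ht]
      exact Submodule.subset_span hx
  · have hx' : x ∈ Submodule.span C (t : Set Γ.Gr) := by
      rw [← SetLike.mem_coe, ht]
      exact hx
    have hC : C ≤ Algebra.adjoin k (↑(s ∪ t) : Set Γ.Gr) := by
      rw [← hs]
      exact Algebra.adjoin_mono (by simp)
    clear hx
    induction hx' using Submodule.span_induction with
    | mem x hx => exact Algebra.subset_adjoin (by simp [hx])
    | zero => exact zero_mem _
    | add x y _ _ hx hy => exact add_mem hx hy
    | smul c x _ hx => exact Subalgebra.mul_mem _ (hC c.2) hx

end Subalgebra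

end AlgFiltration

/-! ### Finite generation through the common subalgebra -/

/-- If, up to multiplication by a nonzero element, the symbols of the elements of `M` lie in a
finitely generated module over an affine algebra `C` of symbols of elements of `T`, then finitely
many elements of `M` generate it over `T` modulo elements of lower degree. -/
theorem SymbolMap.exists_generators_modulo_below {k R A : Type*} [Field k] [Ring R]
    [Algebra k R] {Γ : AlgFiltration k R} [CommRing A] [IsDomain A] [Algebra k A]
    (σ : SymbolMap Γ A) (C : Subalgebra k A) (hCfg : C.FG) (t : Finset A) {w : A} (hw : w ≠ 0)
    (M : Set R) (hM : ∀ (n : ℕ) (a : Γ.piece n), (a : R) ∈ M →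
      w * σ.symb n a ∈ Submodule.span C (t : Set A))
    (T : Set R) (hT0 : 0 ∈ T)
    (hT : ∀ c ∈ C, ∀ n, ∃ r : Γ.piece n, (r : R) ∈ T ∧ σ.comp n c = σ.symb n r) :
    ∃ (N : ℕ) (g : Fin N → R), (∀ i, g i ∈ M) ∧ ∀ n, ∀ m ∈ M, m ∈ Γ.piece n →
      ∃ r : Fin N → R, (∀ i, r i ∈ T) ∧ m - ∑ i, g i * r i ∈ Γ.below n ∧
        m - ∑ i, r i * g i ∈ Γ.below n := by
  classical
  have : Algebra.FiniteType k C := C.fg_iff_finiteType.1 hCfg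
  have : IsNoetherianRing C := Algebra.FiniteType.isNoetherianRing k C
  have : IsNoetherian C (Submodule.span C (t : Set A)) :=
    isNoetherian_span_of_finite C t.finite_toSet
  set G : Set A := {x | ∃ n, ∃ a : Γ.piece n, (a : R) ∈ M ∧ σ.symb n a = x} with hG
  -- Multiplication by `w` is injective on the domain `A` and carries the span into a noetherian
  -- `C`-module.
  have hfg : (Submodule.span C G).FG := by
    refine Submodule.fg_of_fg_map_injective (LinearMap.mulLeft C w)
      (mul_right_injective₀ hw) (isNoetherian_submodule.1 this _ ?_)
    rw [Submodule.map_span_le]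
    rintro _ ⟨n, a, ha, rfl⟩
    exact hM n a ha
  obtain ⟨G₀, hG₀, hspan⟩ := (Submodule.fg_span_iff_fg_span_finset_subset G).1 hfg
  choose d a haM ha using fun i : Fin G₀.card => hG₀ (G₀.equivFin.symm i).2
  refine ⟨G₀.card, fun i => a i, haM, fun n m hm hmn => ?_⟩
  have h1 : σ.symb n ⟨m, hmn⟩ ∈ Submodule.span C (Set.range fun i => σ.symb (d i) (a i)) := by
    refine Submodule.span_mono (s := (G₀ : Set A)) (fun x hx => ?_)
      (hspan ▸ Submodule.subset_span ⟨n, ⟨m, hmn⟩, hm, rfl⟩)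
    exact ⟨G₀.equivFin ⟨x, hx⟩, (ha _).trans (by rw [Equiv.symm_apply_apply])⟩
  obtain ⟨c, hc⟩ := (Submodule.mem_span_range_iff_exists_fun C).1 h1
  -- The coefficients in `C` are not homogeneous, so only the degree `n` part of each term is
  -- lifted. By commutativity of `A` one `r` serves on both sides of `a i`.
  have h2 (i : Fin G₀.card) : ∃ r ∈ T, ∃ (h : (a i : R) * r ∈ Γ.piece n)
      (h' : r * (a i : R) ∈ Γ.piece n),
      σ.comp n (c i • σ.symb (d i) (a i)) = σ.symb n ⟨_, h⟩ ∧
      σ.comp n (c i • σ.symb (d i) (a i)) = σ.symb n ⟨_, h'⟩ := by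
    rw [Subalgebra.smul_def, smul_eq_mul]
    rcases lt_or_ge n (d i) with h | h
    · have h0 : σ.comp n ((c i : A) * σ.symb (d i) (a i)) = 0 := σ.comp_mul_symb_of_lt h _ _
      refine ⟨0, hT0, by simp, by simp, ?_, ?_⟩ <;>
      · rw [h0, eq_comm, σ.symb_eq_zero_iff]
        simp
    · obtain ⟨e, rfl⟩ := Nat.exists_eq_add_of_le' h
      obtain ⟨r, hrT, hr⟩ := hT _ (c i).2 e
      have hl : (a i : R) * r ∈ Γ.piece (e + d i) := by
        rw [add_comm]
        exact Γ.mul_mem (a i).2 r.2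
      refine ⟨r, hrT, hl, Γ.mul_mem r.2 (a i).2, ?_, ?_⟩
      · rw [σ.comp_mul_symb, hr, σ.symb_mul_mem (add_comm (d i) e) (a i) r ⟨_, hl⟩ rfl, mul_comm]
      · rw [σ.comp_mul_symb, hr, σ.symb_mul]
  choose r hrT hl hr hcl hcr using h2
  have h3 : σ.symb n ⟨m, hmn⟩ = ∑ i, σ.comp n (c i • σ.symb (d i) (a i)) := by
    rw [← map_sum, hc, σ.comp_symb_same]
  refine ⟨r, hrT, ?_, ?_⟩
  · have h4 : σ.symb n (⟨m, hmn⟩ - ∑ i, ⟨_, hl i⟩) = 0 := by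
      rw [map_sub, map_sum, h3, sub_eq_zero]
      exact Finset.sum_congr rfl fun i _ => hcl i
    simpa using (σ.symb_eq_zero_iff _).1 h4
  · have h4 : σ.symb n (⟨m, hmn⟩ - ∑ i, ⟨_, hr i⟩) = 0 := by
      rw [map_sub, map_sum, h3, sub_eq_zero]
      exact Finset.sum_congr rfl fun i _ => hcr i
    simpa using (σ.symb_eq_zero_iff _).1 h4

namespace AlgFiltration

variable {k S : Type*} [Field k] [Ring S] [Algebra k S] {Γ : AlgFiltration k S}
  {T T' : Subalgebra k S} {C : Subalgebra k Γ.Gr} {M : AddSubgroup S} {q : S}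

theorem exists_grComp_eq_of_mem_range {x : Γ.Gr} (hx : x ∈ Set.range (Γ.grIncl T)) (n : ℕ) :
    ∃ r : Γ.piece n, (r : S) ∈ T ∧ Γ.grComp n x = Γ.grSymb n r := by
  obtain ⟨x, rfl⟩ := hx
  obtain ⟨r, hr⟩ := (Γ.induced T).symb_surjective n (x n)
  refine ⟨Γ.pieceIncl T n r, r.1.2, congrArg (DirectSum.lof k ℕ Γ.GrPiece n) ?_⟩
  exact (DirectSum.lmap_apply (Γ.grPieceIncl T) x n).trans
    (by rw [← hr]; rfl)

/-- The two subalgebras have different roles: `T` confines the symbols of `M`, via that of `q`, to a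
finite `C`-module, while `T'` supplies lifts of the coefficients from `C`. This is how finite
generation passes from one ring to the other. -/
theorem exists_generators_modulo_below (hcomm : ∀ x y : Γ.Gr, x * y = y * x) [IsDomain Γ.Gr]
    (hCfg : C.FG) (hC : Γ.GrFiniteOver T C) (hC' : Γ.GrFiniteOver T' C) (hq : q ≠ 0)
    (hM : (∀ m ∈ M, q * m ∈ T) ∨ ∀ m ∈ M, m * q ∈ T) :
    ∃ (N : ℕ) (g : Fin N → S), (∀ i, g i ∈ M) ∧ ∀ n, ∀ m ∈ M, m ∈ Γ.piece n →
      ∃ r : Fin N → T', m - ∑ i, g i * r i ∈ Γ.below n ∧ m - ∑ i, (r i : S) * g i ∈ Γ.below n := by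
  let _ := Γ.grCommRing hcomm
  obtain ⟨-, t, ht⟩ := hC
  obtain ⟨d, hqd, hqb⟩ := Γ.exists_mem_notMem_below hq
  have hmem (n : ℕ) (a : Γ.piece n) (ha : (a : S) ∈ T) :
      Γ.grSymb n a ∈ Submodule.span C (t : Set Γ.Gr) := by
    rw [← SetLike.mem_coe, ht]
    exact ⟨_, Γ.grIncl_grSymb T n ⟨⟨a, ha⟩, a.2⟩⟩
  obtain ⟨N, g, hg, h⟩ := (Γ.symbolMap hcomm).exists_generators_modulo_below C hCfg t
    (w := Γ.grSymb d ⟨q, hqd⟩) (fun h => hqb ((Γ.grSymb_eq_zero_iff _).1 h)) M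
    (fun n a ha => by
      rcases hM with hM | hM
      · exact (Γ.grSymb_mul ⟨q, hqd⟩ a) ▸ hmem _ _ (hM a ha)
      · rw [mul_comm]
        exact (Γ.grSymb_mul a ⟨q, hqd⟩) ▸ hmem _ _ (hM a ha))
    T' T'.zero_mem (fun c hc n => exists_grComp_eq_of_mem_range (hC'.1 hc) n)
  refine ⟨N, g, hg, fun n m hm hmn => ?_⟩
  obtain ⟨r, hr, hr'⟩ := h n m hm hmn
  exact ⟨fun i => ⟨r i, hr i⟩, hr'⟩

/-- A bimodule that can be multiplied into `T` is finitely generated as a right `T'`-module. -/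
theorem rightFG_of_mul_mem (hcomm : ∀ x y : Γ.Gr, x * y = y * x) [IsDomain Γ.Gr]
    (hCfg : C.FG) (hC : Γ.GrFiniteOver T C) (hC' : Γ.GrFiniteOver T' C) (hq : q ≠ 0)
    (hM : (∀ m ∈ M, q * m ∈ T) ∨ ∀ m ∈ M, m * q ∈ T) (hMT : ∀ m ∈ M, ∀ r ∈ T', m * r ∈ M) :
    RightFG T' M := by
  obtain ⟨N, g, hg, h⟩ := exists_generators_modulo_below hcomm hCfg hC hC' hq hM
  refine ⟨N, g, hg, fun m hm => ?_⟩
  obtain ⟨n, hn⟩ := Γ.exhaustive m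
  induction n generalizing m with
  | zero =>
    obtain ⟨r, hr, -⟩ := h 0 m hm hn
    exact ⟨r, sub_eq_zero.1 hr⟩
  | succ n ih =>
    obtain ⟨r, hr, -⟩ := h (n + 1) m hm hn
    -- The remainder has lower degree and stays in `M` by stability under `T'`.
    obtain ⟨s, hs⟩ := ih _ (sub_mem hm (sum_mem fun i _ => hMT _ (hg i) _ (r i).2)) hr
    refine ⟨s + r, ?_⟩
    rw [sub_eq_iff_eq_add] at hs
    rw [hs, ← Finset.sum_add_distrib]
    exact Finset.sum_congr rfl fun i _ => (mul_add _ _ _).symm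

/-- A bimodule that can be multiplied into `T` is finitely generated as a left `T'`-module. -/
theorem leftFG_of_mul_mem (hcomm : ∀ x y : Γ.Gr, x * y = y * x) [IsDomain Γ.Gr]
    (hCfg : C.FG) (hC : Γ.GrFiniteOver T C) (hC' : Γ.GrFiniteOver T' C) (hq : q ≠ 0)
    (hM : (∀ m ∈ M, q * m ∈ T) ∨ ∀ m ∈ M, m * q ∈ T) (hMT : ∀ r ∈ T', ∀ m ∈ M, r * m ∈ M) :
    LeftFG T' M := by
  obtain ⟨N, g, hg, h⟩ := exists_generators_modulo_below hcomm hCfg hC hC' hq hM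
  refine ⟨N, g, hg, fun m hm => ?_⟩
  obtain ⟨n, hn⟩ := Γ.exhaustive m
  induction n generalizing m with
  | zero =>
    obtain ⟨r, -, hr⟩ := h 0 m hm hn
    exact ⟨r, sub_eq_zero.1 hr⟩
  | succ n ih =>
    obtain ⟨r, -, hr⟩ := h (n + 1) m hm hn
    obtain ⟨s, hs⟩ := ih _ (sub_mem hm (sum_mem fun i _ => hMT _ (r i).2 _ (hg i))) hr
    refine ⟨s + r, ?_⟩
    rw [sub_eq_iff_eq_add] at hs
    rw [hs, ← Finset.sum_add_distrib]
    exact Finset.sum_congr rfl fun i _ => (add_mul _ _ _).symm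

end AlgFiltration

/-! ### Denominators, cancellation in the quotient ring, and reflexivity -/

section Duality

variable {k S F : Type*} [Field k] [Ring S] [Algebra k S] [DivisionRing F] {ι : S →+* F}
  {R R₁ R₂ : Subalgebra k S} {M : AddSubgroup S}

/-- A finitely generated left module has a common right denominator. -/
theorem LeftFG.exists_mul_mem (hι : Function.Injective ι) (hF : IsGoldieQuotientRing R ι)
    (hM : LeftFG R M) : ∃ q ≠ 0, ∀ m ∈ M, m * q ∈ R := by
  have : Nontrivial S := ι.domain_nontrivial
  obtain ⟨n, g, -, h⟩ := hM
  have hex (s : Finset (Fin n)) : ∃ q ∈ R, q ≠ 0 ∧ ∀ i ∈ s, g i * q ∈ R := by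
    classical
    induction s using Finset.induction_on with
    | empty => exact ⟨1, R.one_mem, one_ne_zero, by simp⟩
    | insert j s _ ih =>
      obtain ⟨q, hq, hq0, hs⟩ := ih
      obtain ⟨-, a, ha, b, hb, hb0, hab⟩ := hF (ι (g j * q))
      rw [eq_mul_inv_iff_mul_eq₀ hb0, ← map_mul] at hab
      refine ⟨q * b, R.mul_mem hq hb, fun h0 => ?_, fun i hi => ?_⟩
      · have := congrArg ι h0
        rw [map_mul, map_zero, mul_eq_zero, or_iff_left hb0] at this
        exact hq0 (hι (this.trans (map_zero ι).symm))
      · rw [← mul_assoc]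
        rcases Finset.mem_insert.1 hi with rfl | hi
        · rw [hι hab]
          exact ha
        · exact R.mul_mem (hs i hi) hb
  obtain ⟨q, -, hq0, hq⟩ := hex Finset.univ
  refine ⟨q, hq0, fun m hm => ?_⟩
  obtain ⟨r, rfl⟩ := h m hm
  rw [Finset.sum_mul]
  refine sum_mem fun i _ => ?_
  rw [mul_assoc]
  exact R.mul_mem (r i).2 (hq i (Finset.mem_univ i))

/-- A finitely generated right module has a common left denominator. -/
theorem RightFG.exists_mul_mem (hι : Function.Injective ι) (hF : IsGoldieQuotientRing R ι)
    (hM : RightFG R M) : ∃ q ≠ 0, ∀ m ∈ M, q * m ∈ R := by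
  have : Nontrivial S := ι.domain_nontrivial
  obtain ⟨n, g, -, h⟩ := hM
  have hex (s : Finset (Fin n)) : ∃ q ∈ R, q ≠ 0 ∧ ∀ i ∈ s, q * g i ∈ R := by
    classical
    induction s using Finset.induction_on with
    | empty => exact ⟨1, R.one_mem, one_ne_zero, by simp⟩
    | insert j s _ ih =>
      obtain ⟨q, hq, hq0, hs⟩ := ih
      obtain ⟨⟨a, ha, b, hb, hb0, hab⟩, -⟩ := hF (ι (q * g j))
      rw [eq_inv_mul_iff_mul_eq₀ hb0, ← map_mul] at hab
      refine ⟨b * q, R.mul_mem hb hq, fun h0 => ?_, fun i hi => ?_⟩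
      · have := congrArg ι h0
        rw [map_mul, map_zero, mul_eq_zero, or_iff_right hb0] at this
        exact hq0 (hι (this.trans (map_zero ι).symm))
      · rw [mul_assoc]
        rcases Finset.mem_insert.1 hi with rfl | hi
        · rw [hι hab]
          exact ha
        · exact R.mul_mem hb (hs i hi)
  obtain ⟨q, -, hq0, hq⟩ := hex Finset.univ
  refine ⟨q, hq0, fun m hm => ?_⟩
  obtain ⟨r, rfl⟩ := h m hm
  rw [Finset.mul_sum]
  refine sum_mem fun i _ => ?_
  rw [← mul_assoc]
  exact R.mul_mem (hq i (Finset.mem_univ i)) (r i).2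

/-- Nonzero two-sided ideals of `R` can be cancelled in divisibility statements: `I a ⊆ R b` implies
`a ∈ R b` and `a I ⊆ b R` implies `a ∈ b R`. -/
def IdealCancel (R : Type*) [Ring R] : Prop :=
  ∀ (I : Ideal R) [I.IsTwoSided], I ≠ ⊥ → ∀ b : R, b ≠ 0 → ∀ a : R,
    ((∀ r ∈ I, ∃ s, r * a = s * b) → ∃ s, a = s * b) ∧
      ((∀ r ∈ I, ∃ s, a * r = b * s) → ∃ s, a = b * s)

/-- With `y = a b⁻¹`, the denominator on the side away from `I`, the condition `I y ⊆ R` becomes `I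
a ⊆ R b`. -/
theorem IdealCancel.mem_of_forall_mul_mem (hR : IdealCancel R) (hι : Function.Injective ι)
    (hF : IsGoldieQuotientRing R ι) (I : Ideal R) [I.IsTwoSided] (hI : I ≠ ⊥) {y : F}
    (hy : ∀ r ∈ I, ι r * y ∈ ι '' R) : y ∈ ι '' R := by
  obtain ⟨-, a, ha, b, hb, hb0, rfl⟩ := hF y
  obtain ⟨s, hs⟩ := (hR I hI ⟨b, hb⟩ (fun h => hb0 (by
    rw [show b = 0 from congrArg Subtype.val h, map_zero])) ⟨a, ha⟩).1 fun r hr => by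
      obtain ⟨s, hs, h⟩ := hy r hr
      refine ⟨⟨s, hs⟩, Subtype.ext (hι ?_)⟩
      rw [← mul_assoc, eq_mul_inv_iff_mul_eq₀ hb0, ← map_mul, ← map_mul] at h
      exact h.symm
  refine ⟨s, s.2, ?_⟩
  rw [eq_mul_inv_iff_mul_eq₀ hb0, ← map_mul]
  exact congrArg ι (congrArg Subtype.val hs).symm

theorem IdealCancel.mem_of_forall_mem_mul (hR : IdealCancel R) (hι : Function.Injective ι)
    (hF : IsGoldieQuotientRing R ι) (I : Ideal R) [I.IsTwoSided] (hI : I ≠ ⊥) {y : F}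
    (hy : ∀ r ∈ I, y * ι r ∈ ι '' R) : y ∈ ι '' R := by
  obtain ⟨⟨a, ha, b, hb, hb0, rfl⟩, -⟩ := hF y
  obtain ⟨s, hs⟩ := (hR I hI ⟨b, hb⟩ (fun h => hb0 (by
    rw [show b = 0 from congrArg Subtype.val h, map_zero])) ⟨a, ha⟩).2 fun r hr => by
      obtain ⟨s, hs, h⟩ := hy r hr
      refine ⟨⟨s, hs⟩, Subtype.ext (hι ?_)⟩
      rw [mul_assoc, eq_inv_mul_iff_mul_eq₀ hb0, ← map_mul, ← map_mul] at h
      exact h.symm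
  refine ⟨s, s.2, ?_⟩
  rw [eq_inv_mul_iff_mul_eq₀ hb0, ← map_mul]
  exact congrArg ι (congrArg Subtype.val hs).symm

/-- A left reflexive bimodule contains every left `R₁`-stable set that can be multiplied into `R₂`
from the left. -/
theorem LeftReflexive.subset (hR : IdealCancel R₁) (hι : Function.Injective ι)
    (hF : IsGoldieQuotientRing R₁ ι) (hM0 : M ≠ ⊥) (hM : IsBisubmodule R₁ R₂ M)
    (hrefl : LeftReflexive R₁ ι M) {X : Set F} (hX : ∀ r ∈ R₁, ∀ x ∈ X, ι r * x ∈ X)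
    {q : F} (hq : q ≠ 0) (hqX : ∀ x ∈ X, q * x ∈ ι '' R₂) : X ⊆ ι '' M := by
  obtain ⟨m, hm, hm0⟩ := M.bot_or_exists_ne_zero.resolve_left hM0
  -- It is a left ideal because `M` is `R₁`-stable, and a right ideal because `X` is.
  let I : Ideal R₁ :=
    { carrier := {r | ∀ x ∈ X, ι r * x ∈ ι '' M}
      add_mem' := fun {a b} ha hb x hx => by
        obtain ⟨s, hs, h⟩ := ha x hx
        obtain ⟨s', hs', h'⟩ := hb x hx
        exact ⟨s + s', add_mem hs hs', by rw [map_add, h, h', ← add_mul, ← map_add]; rfl⟩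
      zero_mem' := fun x _ => ⟨0, M.zero_mem, by simp⟩
      smul_mem' := fun c r hr x hx => by
        obtain ⟨s, hs, h⟩ := hr x hx
        refine ⟨c * s, hM.1 _ c.2 _ hs, ?_⟩
        rw [map_mul, h, ← mul_assoc, ← map_mul]
        rfl }
  have : I.IsTwoSided := ⟨fun {a} b ha x hx => by
    have := ha _ (hX b b.2 x hx)
    rwa [← mul_assoc, ← map_mul] at this⟩
  have hI : I ≠ ⊥ := by
    -- Since `m q X ⊆ M R₂ ⊆ M`, clearing the left denominator of `m q` gives a nonzero `α = β m q`
    -- in `I`.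
    obtain ⟨⟨α, hα, β, hβ, hβ0, hαβ⟩, -⟩ := hF (ι m * q)
    rw [eq_inv_mul_iff_mul_eq₀ hβ0] at hαβ
    refine (Submodule.ne_bot_iff I).2 ⟨⟨α, hα⟩, fun x hx => ?_, fun h => ?_⟩
    · obtain ⟨s, hs, h⟩ := hqX x hx
      refine ⟨β * (m * s), hM.1 _ hβ _ (hM.2 _ hm _ hs), ?_⟩
      change _ = ι α * x
      rw [← hαβ, map_mul, map_mul, h]
      simp only [mul_assoc]
    · have hα0 : α = 0 := congrArg Subtype.val h
      rw [hα0, map_zero] at hαβ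
      have hm0' : ι m ≠ 0 := fun h => hm0 (hι (h.trans (map_zero ι).symm))
      exact mul_ne_zero hβ0 (mul_ne_zero hm0' hq) hαβ
  rw [← hrefl]
  intro x hx f hf
  refine hR.mem_of_forall_mul_mem hι hF I hI fun r hr => ?_
  rw [← mul_assoc]
  exact hf _ (hr x hx)

/-- A right reflexive bimodule contains every right `R₂`-stable set that can be multiplied into `R₁`
from the right. -/
theorem RightReflexive.subset (hR : IdealCancel R₂) (hι : Function.Injective ι)
    (hF : IsGoldieQuotientRing R₂ ι) (hM0 : M ≠ ⊥) (hM : IsBisubmodule R₁ R₂ M)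
    (hrefl : RightReflexive R₂ ι M) {X : Set F} (hX : ∀ r ∈ R₂, ∀ x ∈ X, x * ι r ∈ X)
    {q : F} (hq : q ≠ 0) (hqX : ∀ x ∈ X, x * q ∈ ι '' R₁) : X ⊆ ι '' M := by
  obtain ⟨m, hm, hm0⟩ := M.bot_or_exists_ne_zero.resolve_left hM0
  let I : Ideal R₂ :=
    { carrier := {r | ∀ x ∈ X, x * ι r ∈ ι '' M}
      add_mem' := fun {a b} ha hb x hx => by
        obtain ⟨s, hs, h⟩ := ha x hx
        obtain ⟨s', hs', h'⟩ := hb x hx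
        exact ⟨s + s', add_mem hs hs', by rw [map_add, h, h', ← mul_add, ← map_add]; rfl⟩
      zero_mem' := fun x _ => ⟨0, M.zero_mem, by simp⟩
      smul_mem' := fun c r hr x hx => by
        have := hr _ (hX c c.2 x hx)
        rwa [mul_assoc, ← map_mul] at this }
  have : I.IsTwoSided := ⟨fun {a} b ha x hx => by
    obtain ⟨s, hs, h⟩ := ha x hx
    refine ⟨s * b, hM.2 _ hs _ b.2, ?_⟩
    rw [map_mul, h, mul_assoc, ← map_mul]
    rfl⟩
  have hI : I ≠ ⊥ := by
    obtain ⟨-, α, hα, β, hβ, hβ0, hαβ⟩ := hF (q * ι m)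
    rw [eq_mul_inv_iff_mul_eq₀ hβ0] at hαβ
    refine (Submodule.ne_bot_iff I).2 ⟨⟨α, hα⟩, fun x hx => ?_, fun h => ?_⟩
    · obtain ⟨s, hs, h⟩ := hqX x hx
      refine ⟨s * m * β, hM.2 _ (hM.1 _ hs _ hm) _ hβ, ?_⟩
      change _ = x * ι α
      rw [← hαβ, map_mul, map_mul, h]
      simp only [mul_assoc]
    · have hα0 : α = 0 := congrArg Subtype.val h
      rw [hα0, map_zero] at hαβ
      have hm0' : ι m ≠ 0 := fun h => hm0 (hι (h.trans (map_zero ι).symm))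
      exact mul_ne_zero (mul_ne_zero hq hm0') hβ0 hαβ
  rw [← hrefl]
  intro x hx f hf
  refine hR.mem_of_forall_mem_mul hι hF I hI fun r hr => ?_
  rw [mul_assoc]
  exact hf _ (hr x hx)

/-- The inclusion is applied with `X` the right bidual of `M`: it is `R₁`-stable because `M` is, and
`q` lies in the right dual, so `q X ⊆ R₂`. -/
theorem LeftReflexive.rightReflexive (hR : IdealCancel R₁) (hι : Function.Injective ι)
    (hF : IsGoldieQuotientRing R₁ ι) (hM0 : M ≠ ⊥) (hM : IsBisubmodule R₁ R₂ M)
    (hrefl : LeftReflexive R₁ ι M) {q : S} (hq : q ≠ 0) (hqM : ∀ m ∈ M, q * m ∈ R₂) :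
    RightReflexive R₂ ι M := by
  refine subset_antisymm (hrefl.subset hR hι hF hM0 hM (q := ι q) (fun r hr x hx f hf => ?_)
    (fun h => hq (hι (h.trans (map_zero ι).symm))) fun x hx => hx (ι q) ?_) fun x hx f hf => hf x hx
  · rw [← mul_assoc]
    refine hx _ ?_
    rintro _ ⟨m, hm, rfl⟩
    rw [mul_assoc, ← map_mul]
    exact hf _ ⟨_, hM.1 _ hr _ hm, rfl⟩
  · rintro _ ⟨m, hm, rfl⟩
    exact ⟨_, hqM m hm, map_mul _ _ _⟩

theorem RightReflexive.leftReflexive (hR : IdealCancel R₂) (hι : Function.Injective ι)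
    (hF : IsGoldieQuotientRing R₂ ι) (hM0 : M ≠ ⊥) (hM : IsBisubmodule R₁ R₂ M)
    (hrefl : RightReflexive R₂ ι M) {q : S} (hq : q ≠ 0) (hqM : ∀ m ∈ M, m * q ∈ R₁) :
    LeftReflexive R₁ ι M := by
  refine subset_antisymm (hrefl.subset hR hι hF hM0 hM (q := ι q) (fun r hr x hx f hf => ?_)
    (fun h => hq (hι (h.trans (map_zero ι).symm))) fun x hx => hx (ι q) ?_) fun x hx f hf => hf x hx
  · rw [mul_assoc]
    refine hx _ ?_
    rintro _ ⟨m, hm, rfl⟩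
    rw [← mul_assoc, ← map_mul]
    exact hf _ ⟨_, hM.2 _ hm _ hr, rfl⟩
  · rintro _ ⟨m, hm, rfl⟩
    exact ⟨_, hqM m hm, map_mul _ _ _⟩

theorem AlgFiltration.idealCancel_of_isGorensteinRing {Γ : AlgFiltration k S} [IsDomain Γ.Gr]
    (hG : IsGorensteinRing (Γ.induced R).Gr) {C : Subalgebra k Γ.Gr} (hCfg : C.FG)
    (hC : Γ.GrFiniteOver R C)
    (hGK : ∀ (I : Ideal R) [I.IsTwoSided], I ≠ ⊥ → gkDim k (R ⧸ I) ≤ gkDim k R - 2) :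
    IdealCancel R := by
  intro I _ hI b hb a
  have := Γ.isDomain_gr_induced R
  exact (Γ.induced R).exists_eq_mul_of_gkDim_quotient_le (hC.finiteType hCfg) hG I (hGK I hI) hb a

end Duality

/-! ### Assembly of the theorem -/

theorem theorem3p6 {k S F : Type*} [Field k] [Ring S] [Algebra k S] [DivisionRing F]
    -- the filtered algebra `(S, Γ)`, with `gr_Γ S` a commutative domain
    (Γ : AlgFiltration k S)
    (hcomm : ∀ x y : Γ.Gr, x * y = y * x) (hdom : IsDomain Γ.Gr)
    (R₁ R₂ : Subalgebra k S)
    -- `S` is contained in `F`, the common Goldie quotient ring of `R₁` and `R₂`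
    (ι : S →+* F) (hι : Function.Injective ι)
    (hF₁ : IsGoldieQuotientRing R₁ ι) (hF₂ : IsGoldieQuotientRing R₂ ι)
    -- the associated graded rings are Gorenstein and finite over a common graded algebra `C`
    (hG₁ : IsGorensteinRing (Γ.induced R₁).Gr) (hG₂ : IsGorensteinRing (Γ.induced R₂).Gr)
    (C : Subalgebra k Γ.Gr) (hCgr : Γ.IsGradedSubalgebra C) (hCfg : C.FG)
    (hC₁ : Γ.GrFiniteOver R₁ C) (hC₂ : Γ.GrFiniteOver R₂ C)
    -- proper factor rings drop the Gelfand-Kirillov dimension by at least two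
    (hGK₁ : ∀ (I : Ideal R₁) [I.IsTwoSided], I ≠ ⊥ → gkDim k (R₁ ⧸ I) ≤ gkDim k R₁ - 2)
    (hGK₂ : ∀ (I : Ideal R₂) [I.IsTwoSided], I ≠ ⊥ → gkDim k (R₂ ⧸ I) ≤ gkDim k R₂ - 2)
    (M : AddSubgroup S) (hM0 : M ≠ ⊥) (hM : IsBisubmodule R₁ R₂ M)
    (hside : (LeftFG R₁ M ∧ LeftReflexive R₁ ι M) ∨ (RightFG R₂ M ∧ RightReflexive R₂ ι M)) :
    (LeftFG R₁ M ∧ LeftReflexive R₁ ι M ∧ RightFG R₂ M ∧ RightReflexive R₂ ι M) ∧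
    ∀ N : AddSubgroup S, N ≠ ⊥ → IsBisubmodule R₁ R₂ N →
      ((LeftFG R₁ N ∧ LeftReflexive R₁ ι N) ∨ (RightFG R₂ N ∧ RightReflexive R₂ ι N)) →
      N = M := by
  have hR₁ : IdealCancel R₁ := AlgFiltration.idealCancel_of_isGorensteinRing hG₁ hCfg hC₁ hGK₁
  have hR₂ : IdealCancel R₂ := AlgFiltration.idealCancel_of_isGorensteinRing hG₂ hCfg hC₂ hGK₂
  -- Two denominators are needed: one over the given side to transfer finite generation, then one
  -- over the other side to transfer reflexivity.
  have both (N : AddSubgroup S) (hN0 : N ≠ ⊥) (hN : IsBisubmodule R₁ R₂ N)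
      (h : (LeftFG R₁ N ∧ LeftReflexive R₁ ι N) ∨ (RightFG R₂ N ∧ RightReflexive R₂ ι N)) :
      LeftFG R₁ N ∧ LeftReflexive R₁ ι N ∧ RightFG R₂ N ∧ RightReflexive R₂ ι N := by
    rcases h with ⟨hfg, hrefl⟩ | ⟨hfg, hrefl⟩
    · obtain ⟨q, hq, hqN⟩ := hfg.exists_mul_mem hι hF₁
      have hfg' : RightFG R₂ N :=
        AlgFiltration.rightFG_of_mul_mem hcomm hCfg hC₁ hC₂ hq (Or.inr hqN) hN.2
      obtain ⟨q', hq', hqN'⟩ := hfg'.exists_mul_mem hι hF₂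
      exact ⟨hfg, hrefl, hfg', hrefl.rightReflexive hR₁ hι hF₁ hN0 hN hq' hqN'⟩
    · obtain ⟨q, hq, hqN⟩ := hfg.exists_mul_mem hι hF₂
      have hfg' : LeftFG R₁ N :=
        AlgFiltration.leftFG_of_mul_mem hcomm hCfg hC₂ hC₁ hq (Or.inl hqN) hN.1
      obtain ⟨q', hq', hqN'⟩ := hfg'.exists_mul_mem hι hF₁
      exact ⟨hfg', hrefl.leftReflexive hR₂ hι hF₂ hN0 hN hq' hqN', hfg, hrefl⟩
  -- With both properties known on both sides, this inclusion can be used with the roles of the two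
  -- bimodules exchanged.
  have le (N P : AddSubgroup S) (hN : IsBisubmodule R₁ R₂ N) (hNfg : RightFG R₂ N) (hP0 : P ≠ ⊥)
      (hP : IsBisubmodule R₁ R₂ P) (hPrefl : LeftReflexive R₁ ι P) : N ≤ P := by
    obtain ⟨q, hq, hqN⟩ := hNfg.exists_mul_mem hι hF₂
    have h : ι '' N ⊆ ι '' P := by
      refine hPrefl.subset hR₁ hι hF₁ hP0 hP (q := ι q) ?_
        (fun h => hq (hι (h.trans (map_zero ι).symm))) ?_
      · rintro r hr _ ⟨x, hx, rfl⟩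
        exact ⟨_, hN.1 _ hr _ hx, map_mul _ _ _⟩
      · rintro _ ⟨x, hx, rfl⟩
        exact ⟨_, hqN x hx, map_mul _ _ _⟩
    exact (Set.image_subset_image_iff hι).1 h
  have hMall := both M hM0 hM hside
  refine ⟨hMall, fun N hN0 hN hNside => ?_⟩
  have hNall := both N hN0 hN hNside
  exact le_antisymm (le N M hN hNall.2.2.1 hM0 hM hMall.2.1)
    (le M N hM hMall.2.2.1 hN0 hN hNall.2.1)
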